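/- Let $n\ge 3$. Let $\mathcal M_{0,n,\mathrm{trop}}$ be the set of isomorphism classes of rational $n$-marked abstract tropical curves $(\Gamma,x_1,\dots,x_n)$: connected metric graphs of genus $0$ with exactly $n$ unbounded edges, labelled $x_1,\dots,x_n$, with bounded edges of positive length, and with all vertices of valence at least $3$. Let $\mathrm{dist}_n:\mathcal M_{0,n,\mathrm{trop}}\to\mathbb R^{\binom n2}$ send a curve to the vector, indexed by the two-element subsets $\{i,j\}$ of $[n]=\{1,\dots,n\}$, of the distances between $x_i$ and $x_j$ (the sum of the lengths of the bounded edges on the path from $x_i$ to $x_j$). Let $\Phi_n:\mathbb R^n\to\mathbb R^{\binom n2}$, $a\mapsto(a_i+a_j)_{\{i,j\}}$, let $Q_n=\mathbb R^{\binom n2}/\operatorname{im}\Phi_n$ with projection $q_n$, and let $\varphi_n=q_n\circ\mathrm{dist}_n$. For $I\subset[n]$ with $1<|I|<n-1$ let $v_I\in Q_n$ be the image under $\varphi_n$ of the curve with exactly one bounded edge, of length $1$, with the ends labelled by $I$ on one side of it and the other ends on the other side. Let $\Lambda_n\subset Q_n$ be the subgroup generated by all $v_I$. For a combinatorial type $T$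 of such curves let $\sigma_T\subset Q_n$ be the set of the vectors $q_n((d_{ij})_{\{i,j\}})$, where the bounded edges of $T$ are given arbitrary non-negative lengths and $d_{ij}$ is the resulting distance between $x_i$ and $x_j$. Then $\Lambda_n$ is a lattice in $Q_n$ (the integral span of an $\mathbb R$-basis of $Q_n$), the map $\varphi_n$ is injective, and the set $X$ of all $\sigma_T$ is a simplicial fan in $Q_n$ with respect to $\Lambda_n$, of pure dimension $n-3$, whose union is $\varphi_n(\mathcal M_{0,n,\mathrm{trop}})$; the dimension of $\sigma_T$ is the number of bounded edges of $T$, and the one-dimensional cones of $X$ are exactly the rays $\mathbb R_{\ge0}v_I$. Marking each ray $\mathbb R_{\ge 0}v_I$ by the vector $v_I$ (which is well defined) makes $X$ into a marked fan, and this marked fan is a tropical fan of dimension $n-3$ in $Q_n$ with lattice $\Lambda_n$, in the following sense. For a cone $\sigma\in X$ let $V_\sigma$ be its linear span, let $\Lambda_\sigma=V_\sigma\cap\Lambda_n$, let $\tilde\Lambda_\sigma$ be the subgroup generated by the marking vectors of the one-dimensional faces of $\sigma$, and let $\omega(\sigma)=|\Lambda_\sigma/\tilde\Lambda_\sigma|$.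 Then $\omega(\sigma)$ is a positive integer for every $\sigma\in X$ of dimension $n-3$, and the balancing condition $$\sum_{\sigma>\tau}\omega(\sigma)\,u_{\sigma/\tau}=0\quad\in Q_n/V_\tau$$ holds for every $\tau\in X$ of dimension $n-4$. Here the sum runs over the cones $\sigma\in X$ of dimension $n-3$ that have $\tau$ as a face, and $u_{\sigma/\tau}$ is the generator of $\Lambda_\sigma/\Lambda_\tau\cong\mathbb Z$ that lies on the same side as $\sigma$ in the line $V_\sigma/V_\tau$. -/

import Mathlib

noncomputable section

/-! ## Cones and fans in a real vector space `V` with respect to a lattice `Λ` -/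

section Fans

variable {V : Type*} [AddCommGroup V] [Module ℝ V]

/-- `Λ` is a lattice in `V` with `V = Λ ⊗ ℝ`: it is the integral span of an `ℝ`-basis of `V`. -/
def IsLatticeIn (Λ : Submodule ℤ V) : Prop :=
  ∃ (k : ℕ) (b : Module.Basis (Fin k) ℝ V), Λ = Submodule.span ℤ (Set.range b)

/-- The linear form `f` belongs to the dual lattice of `Λ`. -/
def IsIntegralForm (Λ : Submodule ℤ V) (f : Module.Dual ℝ V) : Prop :=
  ∀ x ∈ Λ, ∃ k : ℤ, f x = k

/-- The set of solutions of `f = 0` for `f ∈ F` and `g ≥ 0` for `g ∈ G`. -/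
def solutionSet (F G : Set (Module.Dual ℝ V)) : Set V :=
  {x | (∀ f ∈ F, f x = 0) ∧ (∀ g ∈ G, 0 ≤ g x)}

/-- `F` and `G` are finite sets of integral linear forms whose equalities and (non-strict)
inequalities describe `σ`. -/
def Describes (Λ : Submodule ℤ V) (F G : Set (Module.Dual ℝ V)) (σ : Set V) : Prop :=
  F.Finite ∧ G.Finite ∧ (∀ f ∈ F, IsIntegralForm Λ f) ∧ (∀ g ∈ G, IsIntegralForm Λ g) ∧
    σ = solutionSet F G

/-- Cones: given by finitely many linear integral equalities and inequalities. -/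
def IsCone (Λ : Submodule ℤ V) (σ : Set V) : Prop :=
  ∃ F G : Set (Module.Dual ℝ V), Describes Λ F G σ

/-- `τ` is a face of the cone `σ` (`τ ≤ σ`): it is obtained from `σ` by changing some of the
inequalities to equalities. -/
def IsFace (Λ : Submodule ℤ V) (τ σ : Set V) : Prop :=
  ∃ F G H : Set (Module.Dual ℝ V), Describes Λ F G σ ∧ H ⊆ G ∧ τ = solutionSet (F ∪ H) G

/-- `dim σ`, the dimension of the linear span `V_σ` of `σ`. -/
def coneDim (σ : Set V) : ℕ := Module.finrank ℝ (Submodule.span ℝ σ)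

/-- The sublattice `Λ_σ = V_σ ∩ Λ`. -/
def coneLattice (Λ : Submodule ℤ V) (σ : Set V) : Submodule ℤ V :=
  (Submodule.span ℝ σ).restrictScalars ℤ ⊓ Λ

/-- The set of non-negative combinations of a finite family of vectors. -/
def generatedCone {k : ℕ} (u : Fin k → V) : Set V :=
  {x | ∃ c : Fin k → ℝ, (∀ i, 0 ≤ c i) ∧ x = ∑ i, c i • u i}

/-- The ray `ℝ_{≥ 0} · v`. -/
def ray (v : V) : Set V := {x | ∃ c : ℝ, 0 ≤ c ∧ x = c • v}

/-- A cone is simplicial if it can be generated by `dim σ` integral vectors. -/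
def IsSimplicialCone (Λ : Submodule ℤ V) (σ : Set V) : Prop :=
  ∃ u : Fin (coneDim σ) → V, (∀ i, u i ∈ Λ) ∧ σ = generatedCone u

/-- Fans (cones need not be strictly convex). -/
structure IsFan (Λ : Submodule ℤ V) (X : Set (Set V)) : Prop where
  finite : X.Finite
  isCone : ∀ σ ∈ X, IsCone Λ σ
  face_mem : ∀ σ ∈ X, ∀ τ, IsFace Λ τ σ → τ ∈ X
  inter_face : ∀ σ ∈ X, ∀ σ' ∈ X, IsFace Λ (σ ∩ σ') σ ∧ IsFace Λ (σ ∩ σ') σ'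

/-- The set `X^{(k)}` of the `k`-dimensional cones of `X`. -/
def conesOfDim (X : Set (Set V)) (k : ℕ) : Set (Set V) := {σ ∈ X | coneDim σ = k}

/-- `X` has dimension `d` and is pure-dimensional: `d` is the biggest dimension of a cone in `X`,
and each inclusion-maximal cone of `X` has this dimension. -/
def HasPureDim (X : Set (Set V)) (d : ℕ) : Prop :=
  IsGreatest (coneDim '' X) d ∧
    ∀ σ ∈ X, (∀ σ' ∈ X, σ ⊆ σ' → σ' = σ) → coneDim σ = d

/-- Weighted fans of pure dimension `d`. Only the values of `ω` on `X^{(d)}` matter. -/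
structure IsWeightedFan (Λ : Submodule ℤ V) (X : Set (Set V)) (d : ℕ) (ω : Set V → ℕ) :
    Prop where
  isFan : IsFan Λ X
  pure : HasPureDim X d
  weight_pos : ∀ σ ∈ conesOfDim X d, 0 < ω σ

/-- `u` represents the primitive normal vector `u_{σ/τ} ∈ Λ_σ / Λ_τ`: its class generates
`Λ_σ / Λ_τ`, and it lies in the half-space of `V_σ / V_τ` that contains `σ / V_τ`. -/
def IsNormalVector (Λ : Submodule ℤ V) (τ σ : Set V) (u : V) : Prop :=
  u ∈ coneLattice Λ σ ∧
  coneLattice Λ σ = coneLattice Λ τ ⊔ Submodule.span ℤ {u} ∧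
  ∃ g : Module.Dual ℝ V, IsIntegralForm Λ g ∧ (∀ x ∈ τ, g x = 0) ∧ (∀ x ∈ σ, 0 ≤ g x) ∧
    (∃ x ∈ σ, g x ≠ 0) ∧ 0 ≤ g u

/-- Tropical fans of dimension `d`: weighted fans such that at every cone `τ` of dimension `d - 1`
the sum of the `ω(σ) · u_{σ/τ}` over all `σ > τ` of dimension `d` is zero in `V / V_τ`. The family
`u` represents the normal vectors (which are unique modulo `Λ_τ`). -/
structure IsTropicalFan (Λ : Submodule ℤ V) (X : Set (Set V)) (d : ℕ) (ω : Set V → ℕ) :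
    Prop extends IsWeightedFan Λ X d ω where
  balancing : ∀ τ ∈ X, coneDim τ + 1 = d →
    ∃ u : Set V → V,
      (∀ σ ∈ conesOfDim X d, IsFace Λ τ σ → IsNormalVector Λ τ σ (u σ)) ∧
      (∑ᶠ σ ∈ {σ | σ ∈ conesOfDim X d ∧ IsFace Λ τ σ}, (ω σ : ℝ) • u σ) ∈ Submodule.span ℝ τ

/-- Marked fans of pure dimension `d`: simplicial fans with an integral vector
`mark σ ∈ (σ \ {0}) ∩ Λ` for every `σ ∈ X^{(1)}`. -/
structure IsMarkedFan (Λ : Submodule ℤ V) (X : Set (Set V)) (d : ℕ) (mark : Set V → V) :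
    Prop where
  isFan : IsFan Λ X
  pure : HasPureDim X d
  simplicial : ∀ σ ∈ X, IsSimplicialCone Λ σ
  mark_mem : ∀ σ ∈ conesOfDim X 1, mark σ ∈ σ
  mark_ne_zero : ∀ σ ∈ conesOfDim X 1, mark σ ≠ 0
  mark_integral : ∀ σ ∈ conesOfDim X 1, mark σ ∈ Λ

/-- The sublattice of `Λ_σ` spanned by the marking vectors of the edges of `σ`. -/
def markedLattice (Λ : Submodule ℤ V) (X : Set (Set V)) (mark : Set V → V) (σ : Set V) :
    Submodule ℤ V :=
  Submodule.span ℤ {v | ∃ ρ ∈ conesOfDim X 1, IsFace Λ ρ σ ∧ v = mark ρ}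

/-- The weight of a cone of a marked fan: the order of `Λ_σ` modulo the sublattice spanned by the
marking vectors of the edges of `σ`. -/
def markedWeight (Λ : Submodule ℤ V) (X : Set (Set V)) (mark : Set V → V) (σ : Set V) : ℕ :=
  Nat.card (coneLattice Λ σ ⧸ (markedLattice Λ X mark σ).submoduleOf (coneLattice Λ σ))

end Fans

/-! ## Marked rational tropical curves -/

/-- Combinatorial types of rational `n`-marked tropical curves: a finite tree, whose edges are the
bounded edges, with `n` labelled unbounded edges, the `i`-th one attached to the vertex `root i`,
such that every vertex has valence at least `3`. (A connected graph of genus `0` has neither loops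
nor multiple edges.) -/
structure MarkedTree (n : ℕ) where
  Vert : Type
  [finite : Finite Vert]
  graph : SimpleGraph Vert
  isTree : graph.IsTree
  root : Fin n → Vert
  three_le_valence : ∀ v, 3 ≤ (graph.neighborSet v).ncard + {i | root i = v}.ncard

/-- The unique path between two vertices. -/
def MarkedTree.path {n : ℕ} (T : MarkedTree n) (a b : T.Vert) : T.graph.Walk a b :=
  (T.isTree.existsUnique_path a b).choose

lemma MarkedTree.path_isPath {n : ℕ} (T : MarkedTree n) (a b : T.Vert) : (T.path a b).IsPath :=
  (T.isTree.existsUnique_path a b).choose_spec.1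

lemma MarkedTree.eq_path {n : ℕ} (T : MarkedTree n) {a b : T.Vert} (p : T.graph.Walk a b)
    (hp : p.IsPath) : p = T.path a b :=
  (T.isTree.existsUnique_path a b).choose_spec.2 p hp

/-- The sum of the lengths `ℓ e` of the edges `e` on the path between two vertices. -/
def MarkedTree.pathLength {n : ℕ} (T : MarkedTree n) (ℓ : Sym2 T.Vert → ℝ) (a b : T.Vert) : ℝ :=
  ((T.path a b).edges.map ℓ).sum

lemma MarkedTree.pathLength_comm {n : ℕ} (T : MarkedTree n) (ℓ : Sym2 T.Vert → ℝ)
    (a b : T.Vert) : T.pathLength ℓ a b = T.pathLength ℓ b a := by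
  have h := T.eq_path (T.path a b).reverse (T.path_isPath a b).reverse
  rw [MarkedTree.pathLength, MarkedTree.pathLength, ← h]
  simp [List.sum_reverse]

/-- The space of real vectors indexed by the two-element subsets of `{1, …, n}`. -/
abbrev PairSpace (n : ℕ) : Type := {e : Sym2 (Fin n) // ¬ e.IsDiag} → ℝ

/-- The vector of the distances between the marked ends, for a length function on the edges. -/
def MarkedTree.distVec {n : ℕ} (T : MarkedTree n) (ℓ : Sym2 T.Vert → ℝ) : PairSpace n :=
  fun e => Sym2.lift ⟨fun i j => T.pathLength ℓ (T.root i) (T.root j),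
    fun _ _ => T.pathLength_comm ℓ _ _⟩ e.1

/-- Rational `n`-marked abstract tropical curves with precisely `n` ends: a combinatorial type
together with positive lengths of the bounded edges. (The values of `length` on pairs of vertices
that are not edges are irrelevant; they are ignored by the isomorphisms below.) -/
structure TropicalCurve (n : ℕ) extends MarkedTree n where
  length : Sym2 Vert → ℝ
  length_pos : ∀ e ∈ graph.edgeSet, 0 < length e

/-- Isomorphisms of marked tropical curves: they preserve the marked ends and the lengths. -/
def TropicalCurve.Isomorphic {n : ℕ} (C D : TropicalCurve n) : Prop :=
  ∃ f : C.graph ≃g D.graph, (∀ i, f (C.root i) = D.root i) ∧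
    ∀ e ∈ C.graph.edgeSet, D.length (e.map f) = C.length e

lemma TropicalCurve.isomorphic_equivalence (n : ℕ) :
    Equivalence (TropicalCurve.Isomorphic (n := n)) where
  refl C := ⟨SimpleGraph.Iso.refl, fun _ => rfl, fun e _ => by
    induction e with | _ a b => rfl⟩
  symm := by
    rintro C D ⟨f, hr, hl⟩
    refine ⟨f.symm, fun i => by rw [← hr i]; exact f.symm_apply_apply _, fun e he => ?_⟩
    induction e with
    | _ a b =>
      have h := hl s(f.symm a, f.symm b) (f.symm.map_adj_iff.2 he)
      simpa using h.symm
  trans := by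
    rintro C D E ⟨f, hr, hl⟩ ⟨g, hr', hl'⟩
    refine ⟨f.trans g, fun i => ?_, fun e he => ?_⟩
    · rw [← hr' i, ← hr i]; rfl
    · induction e with
      | _ a b =>
        have h := hl s(a, b) he
        have h' := hl' s(f a, f b) (f.map_adj_iff.2 he)
        rw [← h]
        exact h'

instance tropicalCurveSetoid (n : ℕ) : Setoid (TropicalCurve n) :=
  ⟨TropicalCurve.Isomorphic, TropicalCurve.isomorphic_equivalence n⟩

/-- The moduli space `M_{0,n,trop}` of rational `n`-marked abstract tropical curves. -/
def M0nTrop (n : ℕ) : Type 1 := Quotient (tropicalCurveSetoid n)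

/-- The distance vector depends only on the isomorphism class of the curve. -/
lemma TropicalCurve.distVec_congr {n : ℕ} (C D : TropicalCurve n) (h : C ≈ D) :
    C.distVec C.length = D.distVec D.length := by
  obtain ⟨f, hr, hl⟩ := h
  funext e
  obtain ⟨e, he⟩ := e
  induction e with
  | _ i j =>
    change C.pathLength C.length (C.root i) (C.root j)
      = D.pathLength D.length (D.root i) (D.root j)
    rw [← hr i, ← hr j]
    have hp := D.eq_path ((C.path (C.root i) (C.root j)).map f.toHom)
      ((C.path_isPath _ _).map f.injective)
    have hs : D.pathLength D.length (f (C.root i)) (f (C.root j)) =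
        ((((C.path (C.root i) (C.root j)).map f.toHom).edges).map D.length).sum := by
      rw [hp]; rfl
    rw [hs, SimpleGraph.Walk.edges_map, List.map_map]
    unfold MarkedTree.pathLength
    congr 1
    refine List.map_congr_left fun e he => ?_
    exact (hl e (SimpleGraph.Walk.edges_subset_edgeSet _ he)).symm

/-- The map `dist_n : M_{0,n,trop} → ℝ^(n choose 2)`. -/
def distMap (n : ℕ) : M0nTrop n → PairSpace n :=
  Quotient.lift (fun C : TropicalCurve n => C.distVec C.length) TropicalCurve.distVec_congr

/-- The linear map `Φ_n : ℝ^n → ℝ^(n choose 2)`, `a ↦ (a_i + a_j)_{i,j}`. -/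
def Phi (n : ℕ) : (Fin n → ℝ) →ₗ[ℝ] PairSpace n where
  toFun a := fun e => Sym2.lift ⟨fun i j => a i + a j, fun _ _ => add_comm _ _⟩ e.1
  map_add' a b := by
    funext ⟨e, he⟩
    induction e with
    | _ i j => simp only [Sym2.lift_mk, Pi.add_apply]; ring
  map_smul' c a := by
    funext ⟨e, he⟩
    induction e with
    | _ i j => simp only [Sym2.lift_mk, Pi.smul_apply, smul_eq_mul, RingHom.id_apply]; ring

/-- `Q_n = ℝ^(n choose 2) / im Φ_n`. -/
abbrev Q (n : ℕ) : Type := PairSpace n ⧸ LinearMap.range (Phi n)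

/-- The canonical projection `q_n`. -/
def qMap (n : ℕ) : PairSpace n →ₗ[ℝ] Q n := (LinearMap.range (Phi n)).mkQ

/-- `φ_n = q_n ∘ dist_n`. -/
def phiMap (n : ℕ) (C : M0nTrop n) : Q n := qMap n (distMap n C)

/-- The cell of the combinatorial type `T`: the image in `Q_n` of the closed orthant of all
non-negative lengths of the bounded edges (edges of length `0` being contracted). -/
def MarkedTree.cell {n : ℕ} (T : MarkedTree n) : Set (Q n) :=
  {x | ∃ ℓ : Sym2 T.Vert → ℝ, (∀ e ∈ T.graph.edgeSet, 0 ≤ ℓ e) ∧ x = qMap n (T.distVec ℓ)}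

/-- The set of cells that makes `φ_n(M_{0,n,trop})` into a fan, one for each combinatorial type. -/
def moduliFan (n : ℕ) : Set (Set (Q n)) := {σ | ∃ T : MarkedTree n, σ = T.cell}

/-- The index sets `I ⊆ {1, …, n}` with `1 < |I| < n - 1`. -/
abbrev SplitIndex (n : ℕ) : Type := {I : Finset (Fin n) // 1 < I.card ∧ I.card + 1 < n}

/-- The curve with one bounded edge, of length `1`, with the ends in `I` on one side of it and the
other ends on the other side. -/
def splitCurve {n : ℕ} (I : SplitIndex n) : TropicalCurve n where
  Vert := Bool
  graph := ⊤
  isTree := by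
    rw [SimpleGraph.isTree_iff_connected_and_card]
    refine ⟨SimpleGraph.connected_top, ?_⟩
    rw [Nat.card_eq_fintype_card, Nat.card_eq_fintype_card]
    decide
  root i := decide (i ∈ I.1)
  three_le_valence v := by
    obtain ⟨I, h1, h2⟩ := I
    have hn : ((⊤ : SimpleGraph Bool).neighborSet v).ncard = 1 := by
      rw [Set.ncard_eq_one]
      exact ⟨!v, by ext w; cases v <;> cases w <;> simp⟩
    have hr : 2 ≤ {i | decide (i ∈ I) = v}.ncard := by
      cases v with
      | true =>
        have : {i | decide (i ∈ I) = true} = (I : Set (Fin n)) := by ext; simp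
        rw [this, Set.ncard_coe_finset]; omega
      | false =>
        have : {i | decide (i ∈ I) = false} = ((Iᶜ : Finset (Fin n)) : Set (Fin n)) := by
          ext; simp
        rw [this, Set.ncard_coe_finset, Finset.card_compl, Fintype.card_fin]; omega
    show 3 ≤ _ + {i | decide (i ∈ I) = v}.ncard
    omega
  length _ := 1
  length_pos _ _ := one_pos

/-- The vector `v_I ∈ Q_n`. -/
def splitVector {n : ℕ} (I : SplitIndex n) : Q n := phiMap n (Quotient.mk _ (splitCurve I))

/-- The lattice `Λ_n` generated by the vectors `v_I`. -/
def splitLattice (n : ℕ) : Submodule ℤ (Q n) :=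
  Submodule.span ℤ (Set.range (splitVector (n := n)))

end

/-!
A rational marked tropical curve is a weighted set of compatible splits. Fix an end `o` and record
every split of the labels by its part that avoids `o`; two splits are compatible if these parts
are nested or disjoint, so that the combinatorial types are the *hierarchies* (`IsHierarchy`).
Rooting a tree at `o` and sending a vertex to the set of labels below it identifies the tree with
the poset of its clusters, each one joined to its parent (`MarkedTree.exists_represents`,
`IsHierarchy.exists_represents`, `MarkedTree.Represents.exists_iso`). A path crosses the edge above
a cluster `I` if and only if `I` separates its end points, so the distance vector is the sum of the
split metrics of the edges, weighted by their lengths (`MarkedTree.Represents.distVec_eq`). Hence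
the cell of a tree is the cone generated by the `v_I` for the members `I` of its hierarchy.

Coordinates on `Q_n` are the differences of the Gromov products
`g_{ij} = (d_{io} + d_{jo} - d_{ij}) / 2`. The form `g_{ij} - g_{kl}` is integral: if `o ∉ I`, its
value on `v_I` is `1` or `0` according to whether `i, j ∈ I`, minus the same for `k, l`. Three
consequences carry the proof.
* The vectors `v_{\{i, j\}}` for all but one of the pairs avoiding `o` are a basis of `Λ_n`
  (`isLatticeIn_splitLattice`).
* Along a hierarchy, the vectors `v_I` have a dual system of integral forms
  (`IsHierarchy.exists_dual_form`). So every cell is a unimodular simplicial cone: its faces are the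
  cones of the subsets of the hierarchy, and all weights `ω(σ)` are `1`.
* The hierarchy of a positive combination of vectors `v_I` consists of the splits for which all
  quartet differences are positive (`IsHierarchy.mem_iff`). This gives the injectivity of `φ_n`,
  and shows that two cones meet in the cone of the common splits.

A hierarchy has at most `n - 3` members, by counting the branches at the vertices
(`IsHierarchy.sum_card_parts`), and it is not maximal as long as some vertex has at least three
branches besides the one towards `o`: the union of two of them may be added. In codimension one
there is exactly one such vertex `A`, with three branches `B₁, B₂, B₃`; the three facets belong to
the unions of two of them, and balancing is the identity `splitVec_union_add`,
`v_{B₁ ∪ B₂} + v_{B₁ ∪ B₃} + v_{B₂ ∪ B₃} = v_A + v_{B₁} + v_{B₂} + v_{B₃}`.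
-/

/-! ### Cones spanned by part of a lattice basis -/

section UnimodularCones

variable {V : Type*} [AddCommGroup V] [Module ℝ V] {ι : Type*} [DecidableEq ι]

/-- The set of non-negative combinations of the vectors `v i` with `i` in the finite set `S`. -/
def finCone (v : ι → V) (S : Finset ι) : Set V :=
  {x | ∃ c : ι → ℝ, (∀ i ∈ S, 0 ≤ c i) ∧ x = ∑ i ∈ S, c i • v i}

/-- The vectors `v i` with `i ∈ S` belong to `Λ` and have the integral forms `f i` as dual system.
Hence they are part of a `ℤ`-basis of `Λ` if `Λ` is a lattice. -/
structure IsUnimodular (Λ : Submodule ℤ V) (v : ι → V) (S : Finset ι)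
    (f : ι → Module.Dual ℝ V) : Prop where
  mem : ∀ i ∈ S, v i ∈ Λ
  integral : ∀ i ∈ S, IsIntegralForm Λ (f i)
  dual : ∀ i ∈ S, ∀ j ∈ S, f i (v j) = if i = j then 1 else 0

lemma mem_finCone {v : ι → V} {S : Finset ι} {i : ι} (hi : i ∈ S) : v i ∈ finCone v S := by
  refine ⟨Pi.single i 1, fun j _ => ?_, ?_⟩
  · by_cases h : j = i
    · subst h; simp
    · simp [h]
  · rw [Finset.sum_eq_single i] <;> simp +contextual [hi]

lemma finCone_mono {v : ι → V} {S S' : Finset ι} (h : S' ⊆ S) : finCone v S' ⊆ finCone v S := by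
  rintro x ⟨c, hc, rfl⟩
  refine ⟨fun i => if i ∈ S' then c i else 0, fun i _ => ?_, ?_⟩
  · by_cases hi : i ∈ S' <;> simp [hi, hc]
  · rw [← Finset.sum_subset h]
    · exact Finset.sum_congr rfl fun i hi => by simp [hi]
    · intro i _ hi; simp [hi]

lemma span_finCone (v : ι → V) (S : Finset ι) :
    Submodule.span ℝ (finCone v S) = Submodule.span ℝ (v '' S) := by
  apply le_antisymm
  · rw [Submodule.span_le]
    rintro x ⟨c, -, rfl⟩
    exact Submodule.sum_mem _ fun i hi =>
      Submodule.smul_mem _ _ (Submodule.subset_span ⟨i, hi, rfl⟩)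
  · apply Submodule.span_mono
    rintro _ ⟨i, hi, rfl⟩
    exact mem_finCone hi

namespace IsUnimodular

variable {Λ : Submodule ℤ V} {v : ι → V} {S : Finset ι} {f : ι → Module.Dual ℝ V}

lemma subset (h : IsUnimodular Λ v S f) {S' : Finset ι} (hS : S' ⊆ S) : IsUnimodular Λ v S' f :=
  ⟨fun i hi => h.mem i (hS hi), fun i hi => h.integral i (hS hi),
    fun i hi j hj => h.dual i (hS hi) j (hS hj)⟩

lemma apply_sum (h : IsUnimodular Λ v S f) {i : ι} (hi : i ∈ S) (c : ι → ℝ) :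
    f i (∑ j ∈ S, c j • v j) = c i := by
  rw [map_sum, Finset.sum_eq_single i]
  · simp [h.dual i hi i hi]
  · intro j hj hji
    simp [h.dual i hi j hj, Ne.symm hji]
  · exact fun hn => absurd hi hn

lemma linearIndependent (h : IsUnimodular Λ v S f) :
    LinearIndependent ℝ (fun i : S => v i) := by
  rw [Fintype.linearIndependent_iff]
  intro c hc i
  have h0 : ∑ j ∈ S, (if hj : j ∈ S then c ⟨j, hj⟩ else 0) • v j = 0 := by
    rw [← Finset.sum_coe_sort, ← hc]
    exact Finset.sum_congr rfl fun j _ => by simp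
  have := h.apply_sum i.2 (fun j => if hj : j ∈ S then c ⟨j, hj⟩ else 0)
  rw [h0] at this
  simpa using this.symm

lemma coneDim (h : IsUnimodular Λ v S f) : coneDim (finCone v S) = S.card := by
  unfold _root_.coneDim
  rw [span_finCone, Set.image_eq_range]
  have := finrank_span_eq_card h.linearIndependent
  simpa using this

lemma mem_span_iff (h : IsUnimodular Λ v S f) {x : V} :
    x ∈ Submodule.span ℝ (v '' S) ↔ x = ∑ i ∈ S, f i x • v i := by
  constructor
  · intro hx
    obtain ⟨c, rfl⟩ := (Submodule.mem_span_image_finset_iff_exists_fun' ℝ).1 hx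
    exact Finset.sum_congr rfl fun i hi => by rw [h.apply_sum hi]
  · intro hx
    rw [hx]
    exact Submodule.sum_mem _ fun i hi =>
      Submodule.smul_mem _ _ (Submodule.subset_span ⟨i, hi, rfl⟩)

lemma coneLattice_eq (h : IsUnimodular Λ v S f) :
    coneLattice Λ (finCone v S) = Submodule.span ℤ (v '' S) := by
  apply le_antisymm
  · rintro x ⟨hx, hxΛ⟩
    have hx' : x ∈ Submodule.span ℝ (v '' S) := by rw [← span_finCone]; exact hx
    rw [h.mem_span_iff.1 hx']
    refine Submodule.sum_mem _ fun i hi => ?_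
    obtain ⟨k, hk⟩ := h.integral i hi x hxΛ
    rw [hk, Int.cast_smul_eq_zsmul]
    exact Submodule.smul_mem _ _ (Submodule.subset_span ⟨i, hi, rfl⟩)
  · rw [Submodule.span_le]
    rintro _ ⟨i, hi, rfl⟩
    exact ⟨Submodule.subset_span (mem_finCone hi), h.mem i hi⟩

/-- The linear span of the cone is cut out by the coordinates of `x - ∑ i ∈ S, f i x • v i` with
respect to a basis of the lattice. -/
lemma describes (h : IsUnimodular Λ v S f) (hΛ : IsLatticeIn Λ) :
    ∃ F : Set (Module.Dual ℝ V), Describes Λ F (f '' S) (finCone v S) := by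
  obtain ⟨k, b, rfl⟩ := hΛ
  have hb : ∀ a, IsIntegralForm (Submodule.span ℤ (Set.range b)) (b.coord a) := by
    intro a x hx
    obtain ⟨m, hm⟩ := (b.mem_span_iff_repr_mem ℤ x).1 hx a
    exact ⟨m, by simpa using hm.symm⟩
  let P : V →ₗ[ℝ] V := LinearMap.id - ∑ i ∈ S, (f i).smulRight (v i)
  have hP : ∀ x, P x = x - ∑ i ∈ S, f i x • v i := fun x => by simp [P]
  refine ⟨Set.range fun a => b.coord a ∘ₗ P, Set.finite_range _, S.finite_toSet.image _, ?_, ?_, ?_⟩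
  · rintro _ ⟨a, rfl⟩ x hx
    refine hb a _ ?_
    rw [hP]
    refine Submodule.sub_mem _ hx (Submodule.sum_mem _ fun i hi => ?_)
    obtain ⟨m, hm⟩ := h.integral i hi x hx
    rw [hm, Int.cast_smul_eq_zsmul]
    exact Submodule.smul_mem _ _ (h.mem i hi)
  · rintro _ ⟨i, hi, rfl⟩
    exact h.integral i hi
  · ext x
    constructor
    · rintro ⟨c, hc, rfl⟩
      refine ⟨?_, ?_⟩
      · rintro _ ⟨a, rfl⟩
        have : P (∑ i ∈ S, c i • v i) = 0 := by
          rw [hP, sub_eq_zero]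
          exact Finset.sum_congr rfl fun i hi => by rw [h.apply_sum hi]
        rw [LinearMap.comp_apply, this, map_zero]
      · rintro _ ⟨i, hi, rfl⟩
        rw [h.apply_sum hi]
        exact hc i hi
    · rintro ⟨h1, h2⟩
      refine ⟨fun i => f i x, fun i hi => h2 _ ⟨i, hi, rfl⟩, ?_⟩
      rw [← sub_eq_zero, ← hP]
      refine b.ext_elem fun a => ?_
      simpa using h1 _ ⟨a, rfl⟩

lemma isCone (h : IsUnimodular Λ v S f) (hΛ : IsLatticeIn Λ) : IsCone Λ (finCone v S) := by
  obtain ⟨F, hF⟩ := h.describes hΛ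
  exact ⟨F, _, hF⟩

lemma isFace_iff (h : IsUnimodular Λ v S f) (hΛ : IsLatticeIn Λ) {τ : Set V} :
    IsFace Λ τ (finCone v S) ↔ ∃ S' ⊆ S, τ = finCone v S' := by
  classical
  constructor
  · rintro ⟨F, G, H, ⟨-, -, -, -, hσ⟩, hHG, rfl⟩
    have hpos : ∀ g ∈ H, ∀ i ∈ S, 0 ≤ g (v i) := fun g hg i hi => by
      have : v i ∈ solutionSet F G := hσ ▸ mem_finCone hi
      exact this.2 g (hHG hg)
    refine ⟨S.filter fun i => ∀ g ∈ H, g (v i) = 0, Finset.filter_subset _ _, ?_⟩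
    ext x
    constructor
    · rintro ⟨h1, h2⟩
      have hx : x ∈ finCone v S := by
        rw [hσ]; exact ⟨fun g hg => h1 g (Or.inl hg), h2⟩
      obtain ⟨c, hc, rfl⟩ := hx
      refine ⟨c, fun i hi => hc i (Finset.mem_filter.1 hi).1, ?_⟩
      rw [Finset.sum_filter]
      refine Finset.sum_congr rfl fun i hi => ?_
      split_ifs with hi'
      · rfl
      · push Not at hi'
        obtain ⟨g, hg, hgi⟩ := hi'
        have h0 := h1 g (Or.inr hg)
        rw [map_sum, Finset.sum_eq_zero_iff_of_nonneg] at h0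
        · have := h0 i hi
          rw [map_smul, smul_eq_mul, mul_eq_zero, or_iff_left hgi] at this
          rw [this, zero_smul]
        · intro j hj
          rw [map_smul]
          exact mul_nonneg (hc j hj) (hpos g hg j hj)
    · intro hx
      have hx' : x ∈ solutionSet F G := hσ ▸ finCone_mono (Finset.filter_subset _ _) hx
      refine ⟨?_, hx'.2⟩
      rintro g (hg | hg)
      · exact hx'.1 g hg
      · obtain ⟨c, hc, rfl⟩ := hx
        rw [map_sum]
        refine Finset.sum_eq_zero fun i hi => ?_
        rw [map_smul, (Finset.mem_filter.1 hi).2 g hg, smul_zero]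
  · rintro ⟨S', hS, rfl⟩
    obtain ⟨F, hF⟩ := h.describes hΛ
    have hσ := hF.2.2.2.2
    refine ⟨F, f '' S, f '' (S \ S' : Finset ι), hF,
      Set.image_mono (by simp), ?_⟩
    ext x
    constructor
    · intro hx
      have hx' : x ∈ solutionSet F (f '' S) := hσ ▸ finCone_mono hS hx
      refine ⟨?_, hx'.2⟩
      rintro g (hg | ⟨i, hi, rfl⟩)
      · exact hx'.1 g hg
      · obtain ⟨hi1, hi2⟩ := Finset.mem_sdiff.1 (Finset.mem_coe.1 hi)
        obtain ⟨c, hc, rfl⟩ := hx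
        rw [map_sum]
        refine Finset.sum_eq_zero fun j hj => ?_
        rw [map_smul, h.dual i hi1 j (hS hj), if_neg (fun e => hi2 (by rwa [e])), smul_zero]
    · rintro ⟨h1, h2⟩
      have hx : x ∈ finCone v S := by
        rw [hσ]; exact ⟨fun g hg => h1 g (Or.inl hg), h2⟩
      obtain ⟨c, hc, rfl⟩ := hx
      refine ⟨c, fun i hi => hc i (hS hi), ?_⟩
      refine (Finset.sum_subset hS fun i hi hi' => ?_).symm
      have := h1 (f i) (Or.inr ⟨i, by simp [hi, hi'], rfl⟩)
      rw [h.apply_sum hi] at this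
      rw [this, zero_smul]

lemma isSimplicialCone (h : IsUnimodular Λ v S f) : IsSimplicialCone Λ (finCone v S) := by
  unfold IsSimplicialCone
  rw [h.coneDim]
  let e := S.equivFin
  refine ⟨fun a => v (e.symm a), fun a => h.mem _ (e.symm a).2, ?_⟩
  ext x
  constructor
  · rintro ⟨c, hc, rfl⟩
    refine ⟨fun a => c (e.symm a), fun a => hc _ (e.symm a).2, ?_⟩
    rw [← Finset.sum_coe_sort, ← e.symm.sum_comp]
  · rintro ⟨c, hc, rfl⟩
    refine ⟨fun i => if hi : i ∈ S then c (e ⟨i, hi⟩) else 0, fun i hi => by simp [hi, hc], ?_⟩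
    rw [← Finset.sum_coe_sort S, ← e.symm.sum_comp]
    exact Finset.sum_congr rfl fun a _ => by simp

/-- Adding one vector `v i` to a unimodular cone `τ` gives a cone `σ` for which `v i` represents
the primitive normal vector `u_{σ/τ}`. -/
lemma isNormalVector {i : ι} (h : IsUnimodular Λ v (insert i S) f) (hi : i ∉ S) :
    IsNormalVector Λ (finCone v S) (finCone v (insert i S)) (v i) := by
  have hS := h.subset (Finset.subset_insert i S)
  have hi' : i ∈ insert i S := Finset.mem_insert_self _ _
  refine ⟨?_, ?_, f i, h.integral i hi', ?_, ?_, ⟨v i, mem_finCone hi', ?_⟩, ?_⟩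
  · rw [h.coneLattice_eq]
    exact Submodule.subset_span ⟨i, by simp, rfl⟩
  · rw [h.coneLattice_eq, hS.coneLattice_eq, Finset.coe_insert, Set.image_insert_eq,
      Submodule.span_insert, sup_comm]
  · rintro _ ⟨c, -, rfl⟩
    rw [map_sum]
    refine Finset.sum_eq_zero fun j hj => ?_
    rw [map_smul, h.dual i hi' j (Finset.mem_insert_of_mem hj),
      if_neg (fun e => hi (by rwa [e])), smul_zero]
  · rintro _ ⟨c, hc, rfl⟩
    rw [h.apply_sum hi']
    exact hc i hi'
  · simp [h.dual i hi' i hi']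
  · simp [h.dual i hi' i hi']

end IsUnimodular

end UnimodularCones

/-! ### Split vectors and Gromov coordinates on `Q_n` -/

section GromovCoordinates

variable {n : ℕ}

/-- The vector of the split metric of `I`: its `{i, j}`-entry is `1` if `I` separates `i` and `j`,
and `0` otherwise. -/
def splitDist (I : Finset (Fin n)) : PairSpace n :=
  fun e => Sym2.lift ⟨fun i j => if (i ∈ I ↔ j ∈ I) then (0 : ℝ) else 1,
    fun i j => by simp only [iff_comm]⟩ e.1

/-- The class in `Q_n` of the split metric of `I`, for an arbitrary set `I` of labels. -/
def splitVec (I : Finset (Fin n)) : Q n := qMap n (splitDist I)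

lemma splitVec_compl (I : Finset (Fin n)) : splitVec Iᶜ = splitVec I := by
  unfold splitVec
  congr 1
  funext ⟨e, he⟩
  induction e with
  | _ i j => simp [splitDist, not_iff_not]

/-- The entry `d_{ij}` of a vector `d`, extended by `0` to the diagonal. -/
def pairEntry (d : PairSpace n) (i j : Fin n) : ℝ :=
  if h : i = j then 0 else d ⟨s(i, j), h⟩

lemma pairEntry_of_ne (d : PairSpace n) {i j : Fin n} (h : i ≠ j) :
    pairEntry d i j = d ⟨s(i, j), h⟩ := dif_neg h

lemma pairEntry_comm (d : PairSpace n) (i j : Fin n) : pairEntry d i j = pairEntry d j i := by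
  unfold pairEntry
  by_cases h : i = j
  · simp [h]
  · rw [dif_neg h, dif_neg (Ne.symm h)]
    congr 2
    exact Sym2.eq_swap

lemma pairEntry_add (d d' : PairSpace n) (i j : Fin n) :
    pairEntry (d + d') i j = pairEntry d i j + pairEntry d' i j := by
  unfold pairEntry; split_ifs <;> simp

lemma pairEntry_smul (c : ℝ) (d : PairSpace n) (i j : Fin n) :
    pairEntry (c • d) i j = c * pairEntry d i j := by
  unfold pairEntry; split_ifs <;> simp

lemma pairEntry_splitDist (I : Finset (Fin n)) (i j : Fin n) :
    pairEntry (splitDist I) i j = if (i ∈ I ↔ j ∈ I) then (0 : ℝ) else 1 := by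
  unfold pairEntry
  by_cases h : i = j
  · simp [h]
  · rw [dif_neg h]; rfl

/-- The two-element sets of labels that avoid the base label `o`. -/
abbrev BasedPair (o : Fin n) : Type := {e : Sym2 (Fin n) // ¬ e.IsDiag ∧ o ∉ e}

/-- The pair `{i, j}`, as an element of `BasedPair o`. -/
def BasedPair.mk {o i j : Fin n} (hij : i ≠ j) (hi : i ≠ o) (hj : j ≠ o) : BasedPair o :=
  ⟨s(i, j), hij, by simp [hi.symm, hj.symm]⟩

/-- The Gromov product `(d_{io} + d_{jo} - d_{ij}) / 2` with respect to the base label `o`. -/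
noncomputable def gromov (o : Fin n) (e : BasedPair o) : PairSpace n →ₗ[ℝ] ℝ where
  toFun d := Sym2.lift ⟨fun i j => (pairEntry d i o + pairEntry d j o - pairEntry d i j) / 2,
    fun i j => by simp only [pairEntry_comm d i j]; ring⟩ e.1
  map_add' d d' := by
    obtain ⟨e, he⟩ := e
    induction e with
    | _ i j => simp only [Sym2.lift_mk, pairEntry_add]; ring
  map_smul' c d := by
    obtain ⟨e, he⟩ := e
    induction e with
    | _ i j => simp only [Sym2.lift_mk, pairEntry_smul, smul_eq_mul, RingHom.id_apply]; ring

lemma gromov_mk {o i j : Fin n} (hij : i ≠ j) (hi : i ≠ o) (hj : j ≠ o) (d : PairSpace n) :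
    gromov o (.mk hij hi hj) d = (pairEntry d i o + pairEntry d j o - pairEntry d i j) / 2 := rfl

lemma gromov_Phi {o : Fin n} (e : BasedPair o) (a : Fin n → ℝ) : gromov o e (Phi n a) = a o := by
  obtain ⟨e, he⟩ := e
  induction e with
  | _ i j =>
    have hi : i ≠ o := fun h => he.2 (by simp [h])
    have hj : j ≠ o := fun h => he.2 (by simp [h])
    have hij : i ≠ j := he.1
    change gromov o (.mk hij hi hj) _ = _
    rw [gromov_mk, pairEntry_of_ne _ hij, pairEntry_of_ne _ hi, pairEntry_of_ne _ hj]
    change ((a i + a o) + (a j + a o) - (a i + a j)) / 2 = a o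
    ring

lemma gromov_splitDist {o : Fin n} (e : BasedPair o) {I : Finset (Fin n)} (ho : o ∉ I) :
    gromov o e (splitDist I) = if e.1.toFinset ⊆ I then 1 else 0 := by
  obtain ⟨e, he⟩ := e
  induction e with
  | _ i j =>
    have hi : i ≠ o := fun h => he.2 (by simp [h])
    have hj : j ≠ o := fun h => he.2 (by simp [h])
    have hij : i ≠ j := he.1
    change gromov o (.mk hij hi hj) _ = _
    rw [gromov_mk, pairEntry_splitDist, pairEntry_splitDist, pairEntry_splitDist]
    by_cases h1 : i ∈ I <;> by_cases h2 : j ∈ I <;>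
      simp [ho, h1, h2, Sym2.toFinset_mk_eq, Finset.insert_subset_iff]

/-- The difference of two Gromov products, as a linear form on `Q_n`. (A single Gromov product
is not constant on the cosets of `im Φ_n`.) -/
noncomputable def gromovDiff {o : Fin n} (e e' : BasedPair o) : Module.Dual ℝ (Q n) :=
  (LinearMap.range (Phi n)).liftQ (gromov o e - gromov o e') (by
    rintro _ ⟨a, rfl⟩
    simp [gromov_Phi])

lemma gromovDiff_qMap {o : Fin n} (e e' : BasedPair o) (d : PairSpace n) :
    gromovDiff e e' (qMap n d) = gromov o e d - gromov o e' d := rfl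

lemma gromovDiff_splitVec {o : Fin n} (e e' : BasedPair o) {I : Finset (Fin n)} (ho : o ∉ I) :
    gromovDiff e e' (splitVec I) =
      (if e.1.toFinset ⊆ I then 1 else 0) - if e'.1.toFinset ⊆ I then 1 else 0 := by
  rw [splitVec, gromovDiff_qMap, gromov_splitDist e ho, gromov_splitDist e' ho]

/-- The differences of Gromov products separate the points of `Q_n`. -/
lemma eq_zero_of_gromovDiff_eq_zero {o : Fin n} (e₀ : BasedPair o) {x : Q n}
    (h : ∀ e, gromovDiff e e₀ x = 0) : x = 0 := by
  obtain ⟨d, rfl⟩ := Submodule.mkQ_surjective _ x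
  change qMap n d = 0
  have h' : ∀ e, gromov o e d = gromov o e₀ d := fun e => sub_eq_zero.1 (h e)
  set c := gromov o e₀ d with hc
  refine (Submodule.Quotient.mk_eq_zero _).2
    ⟨fun i => if i = o then c else pairEntry d i o - c, ?_⟩
  funext ⟨e, he⟩
  induction e with
  | _ i j =>
    have hij : i ≠ j := he
    change (if i = o then c else pairEntry d i o - c) + (if j = o then c else pairEntry d j o - c)
      = d ⟨s(i, j), hij⟩
    rw [← pairEntry_of_ne d hij]
    by_cases hi : i = o
    · subst hi
      rw [if_pos rfl, if_neg hij.symm, pairEntry_comm d i j]; ring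
    · by_cases hj : j = o
      · subst hj
        rw [if_pos rfl, if_neg hij]; ring
      · rw [if_neg hi, if_neg hj]
        have := h' (.mk hij hi hj)
        rw [gromov_mk] at this
        linarith

lemma splitVec_eq_zero_of_card_le_one {I : Finset (Fin n)} (hn : 3 ≤ n) (hI : I.card ≤ 1) :
    splitVec I = 0 := by
  have hc : 2 ≤ (Iᶜ).card := by rw [Finset.card_compl, Fintype.card_fin]; omega
  obtain ⟨o, ho⟩ : (Iᶜ).Nonempty := Finset.card_pos.1 (by omega)
  have ho : o ∉ I := by simpa using ho
  have h2 : 1 < (Finset.univ.erase o).card := by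
    rw [Finset.card_erase_of_mem (Finset.mem_univ _), Finset.card_univ, Fintype.card_fin]; omega
  obtain ⟨i, hi, j, hj, hij⟩ := Finset.one_lt_card.1 h2
  refine eq_zero_of_gromovDiff_eq_zero
    (.mk hij (Finset.ne_of_mem_erase hi) (Finset.ne_of_mem_erase hj)) fun e => ?_
  have key : ∀ e : BasedPair o, ¬ e.1.toFinset ⊆ I := fun e h => by
    have := Finset.card_le_card h
    rw [Sym2.card_toFinset_of_not_isDiag _ e.2.1] at this
    omega
  rw [gromovDiff_splitVec _ _ ho, if_neg (key _), if_neg (key _), sub_zero]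

lemma splitVec_compl_singleton (hn : 3 ≤ n) (o : Fin n) : splitVec ({o}ᶜ : Finset (Fin n)) = 0 := by
  rw [splitVec_compl]
  exact splitVec_eq_zero_of_card_le_one hn (by simp)

/-! ### The lattice -/

lemma MarkedTree.pathLength_eq (T : MarkedTree n) (ℓ : Sym2 T.Vert → ℝ) {a b : T.Vert}
    (p : T.graph.Walk a b) (hp : p.IsPath) : T.pathLength ℓ a b = (p.edges.map ℓ).sum := by
  rw [T.eq_path p hp]; rfl

lemma splitVector_eq (I : SplitIndex n) : splitVector I = splitVec I.1 := by
  change qMap n ((splitCurve I).distVec (splitCurve I).length) = qMap n _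
  congr 1
  funext ⟨e, he⟩
  induction e with
  | _ i j =>
    change (splitCurve I).pathLength (fun _ => 1) (decide (i ∈ I.1)) (decide (j ∈ I.1)) =
      if (i ∈ I.1 ↔ j ∈ I.1) then (0 : ℝ) else 1
    have key : ∀ a b : Bool, (splitCurve I).pathLength (fun _ => 1) a b =
        if a = b then (0 : ℝ) else 1 := by
      intro a b
      split_ifs with hab
      · subst hab
        exact MarkedTree.pathLength_eq (splitCurve I).toMarkedTree _ .nil .nil
      · have hadj : (splitCurve I).graph.Adj a b := hab
        rw [MarkedTree.pathLength_eq _ _ hadj.toWalk (.of_adj hadj)]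
        exact List.sum_singleton
    rw [key]
    simp [decide_eq_decide]

lemma splitVec_mem {I : Finset (Fin n)} (h1 : 1 < I.card) (h2 : I.card + 1 < n) :
    splitVec I ∈ splitLattice n :=
  Submodule.subset_span ⟨⟨I, h1, h2⟩, splitVector_eq _⟩

lemma gromovDiff_integral {o : Fin n} (e e' : BasedPair o) :
    IsIntegralForm (splitLattice n) (gromovDiff e e') := by
  have key : ∀ I : Finset (Fin n), o ∉ I → ∃ k : ℤ, gromovDiff e e' (splitVec I) = k := by
    intro I ho
    rw [gromovDiff_splitVec _ _ ho]
    exact ⟨(if e.1.toFinset ⊆ I then 1 else 0) - if e'.1.toFinset ⊆ I then 1 else 0,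
      by push_cast; rfl⟩
  intro x hx
  induction hx using Submodule.span_induction with
  | mem x hx =>
    obtain ⟨I, rfl⟩ := hx
    rw [splitVector_eq]
    by_cases ho : o ∈ I.1
    · rw [← splitVec_compl]; exact key _ (by simpa using ho)
    · exact key _ ho
  | zero => exact ⟨0, by simp⟩
  | add x y _ _ hx hy =>
    obtain ⟨k, hk⟩ := hx
    obtain ⟨l, hl⟩ := hy
    exact ⟨k + l, by simp [hk, hl]⟩
  | smul a x _ hx =>
    obtain ⟨k, hk⟩ := hx
    exact ⟨a * k, by simp [hk]⟩

/-- The vectors `v_{\{i, j\}}` for the pairs that avoid a base label, one pair `e₀` excepted, form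
an `ℝ`-basis of `Q_n`; the dual basis consists of the integral forms `gromovDiff e e₀`. -/
lemma isLatticeIn_splitLattice (hn : 3 ≤ n) : IsLatticeIn (splitLattice n) := by
  classical
  let o : Fin n := ⟨0, by omega⟩
  let e₀ : BasedPair o := .mk (i := ⟨1, by omega⟩) (j := ⟨2, by omega⟩) (by simp)
    (by simp [o]) (by simp [o])
  let P := {e : BasedPair o // e ≠ e₀}
  let L : Q n →ₗ[ℝ] (P → ℝ) := LinearMap.pi fun e => gromovDiff e.1 e₀
  have hcard : ∀ e : BasedPair o, e.1.toFinset.card = 2 :=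
    fun e => Sym2.card_toFinset_of_not_isDiag _ e.2.1
  have hsub : ∀ e e' : BasedPair o, e.1.toFinset ⊆ e'.1.toFinset ↔ e = e' := by
    intro e e'
    constructor
    · intro h
      have := Finset.eq_of_subset_of_card_le h (by rw [hcard, hcard])
      refine Subtype.ext (Sym2.ext fun x => ?_)
      rw [← Sym2.mem_toFinset, this, Sym2.mem_toFinset]
    · rintro rfl; rfl
  have hinj : Function.Injective L := by
    rw [injective_iff_map_eq_zero]
    intro x hx
    refine eq_zero_of_gromovDiff_eq_zero e₀ fun e => ?_
    by_cases he : e = e₀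
    · subst he
      obtain ⟨d, rfl⟩ := Submodule.mkQ_surjective _ x
      exact sub_self _
    · exact congrFun hx ⟨e, he⟩
  have hsingle : ∀ e : P, L (splitVec e.1.1.toFinset) = Pi.single e 1 := by
    intro e
    funext e'
    change gromovDiff e'.1 e₀ (splitVec e.1.1.toFinset) = _
    rw [gromovDiff_splitVec _ _ (by rw [Sym2.mem_toFinset]; exact e.1.2.2)]
    rw [if_congr (hsub _ _) rfl rfl, if_congr (hsub _ _) rfl rfl, if_neg (Ne.symm e.2), sub_zero,
      Pi.single_apply, if_congr Subtype.ext_iff.symm rfl rfl]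
  have hsurj : Function.Surjective L := by
    intro y
    refine ⟨∑ e, y e • splitVec e.1.1.toFinset, ?_⟩
    simp only [map_sum, map_smul, hsingle]
    funext e
    simp [P, Finset.sum_apply, Pi.single_apply]
  let b : Module.Basis P ℝ (Q n) := .ofEquivFun (LinearEquiv.ofBijective L ⟨hinj, hsurj⟩)
  have hb : ∀ e, b e = splitVec e.1.1.toFinset := by
    intro e
    apply hinj
    rw [hsingle]
    simp only [b, Module.Basis.coe_ofEquivFun]
    exact (LinearEquiv.ofBijective L ⟨hinj, hsurj⟩).apply_symm_apply _
  have hspan : splitLattice n = Submodule.span ℤ (Set.range b) := by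
    apply le_antisymm
    · intro x hx
      rw [b.mem_span_iff_repr_mem ℤ]
      intro e
      obtain ⟨k, hk⟩ := gromovDiff_integral e.1 e₀ x hx
      exact ⟨k, hk.symm⟩
    · rw [Submodule.span_le]
      rintro _ ⟨e, rfl⟩
      rw [hb]
      refine splitVec_mem (by rw [hcard]; omega) ?_
      -- two different pairs that avoid `o` involve at least four labels together with `o`
      have h1 : e.1.1.toFinset ⊂ e.1.1.toFinset ∪ e₀.1.toFinset := by
        refine Finset.ssubset_iff_subset_ne.2 ⟨Finset.subset_union_left, fun h => ?_⟩
        exact e.2 ((hsub _ _).1 (Finset.union_eq_left.1 h.symm)).symm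
      have h2 : e.1.1.toFinset ∪ e₀.1.toFinset ⊆ Finset.univ.erase o := by
        intro x hx
        rw [Finset.mem_erase]
        refine ⟨?_, Finset.mem_univ _⟩
        rintro rfl
        rw [Finset.mem_union, Sym2.mem_toFinset, Sym2.mem_toFinset] at hx
        exact hx.elim e.1.2.2 e₀.2.2
      have h3 := Finset.card_lt_card h1
      have h4 := Finset.card_le_card h2
      rw [Finset.card_erase_of_mem (Finset.mem_univ _), Finset.card_univ, Fintype.card_fin] at h4
      omega
  let ε := Fintype.equivFin P
  exact ⟨Fintype.card P, b.reindex ε, by rw [hspan, Module.Basis.range_reindex]⟩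

end GromovCoordinates

/-! ### Hierarchies of label sets -/

section Hierarchies

variable {n : ℕ} {o : Fin n} {F : Finset (Finset (Fin n))}

/-- Sets of pairwise compatible splits. A split is recorded by its part that does not contain the
base label `o`; two splits are compatible if these parts are nested or disjoint. -/
structure IsHierarchy (o : Fin n) (F : Finset (Finset (Fin n))) : Prop where
  base_notMem : ∀ I ∈ F, o ∉ I
  one_lt_card : ∀ I ∈ F, 1 < I.card
  card_lt : ∀ I ∈ F, I.card + 1 < n
  nested : ∀ I ∈ F, ∀ J ∈ F, I ⊆ J ∨ J ⊆ I ∨ Disjoint I J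

/-- The members of `F` and the set of all labels different from `o`: the vertices of the tree
of `F`, each given by the labels below it when the tree is rooted at the end `o`. -/
def clusters (o : Fin n) (F : Finset (Finset (Fin n))) : Finset (Finset (Fin n)) :=
  insert {o}ᶜ F

lemma mem_clusters {A : Finset (Fin n)} : A ∈ clusters o F ↔ A = {o}ᶜ ∨ A ∈ F :=
  Finset.mem_insert

lemma card_compl_singleton (o : Fin n) : ({o}ᶜ : Finset (Fin n)).card = n - 1 := by
  rw [Finset.card_compl, Fintype.card_fin, Finset.card_singleton]

lemma subset_compl_singleton_iff {A : Finset (Fin n)} : A ⊆ {o}ᶜ ↔ o ∉ A := by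
  rw [Finset.subset_compl_comm, Finset.singleton_subset_iff, Finset.mem_compl]

/-- The smallest cluster that strictly contains `A`. -/
def parent (o : Fin n) (F : Finset (Finset (Fin n))) (A : Finset (Fin n)) : Finset (Fin n) :=
  ((clusters o F).filter (A ⊂ ·)).inf id

lemma IsHierarchy.subset (h : IsHierarchy o F) {F' : Finset (Finset (Fin n))} (hF : F' ⊆ F) :
    IsHierarchy o F' :=
  ⟨fun I hI => h.base_notMem I (hF hI), fun I hI => h.one_lt_card I (hF hI),
    fun I hI => h.card_lt I (hF hI), fun I hI J hJ => h.nested I (hF hI) J (hF hJ)⟩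

lemma isHierarchy_empty (o : Fin n) : IsHierarchy o ∅ := by constructor <;> simp

namespace IsHierarchy

lemma ne_compl (h : IsHierarchy o F) {I : Finset (Fin n)} (hI : I ∈ F) : I ≠ {o}ᶜ := by
  rintro rfl
  have := h.card_lt _ hI
  rw [card_compl_singleton] at this
  omega

lemma top_notMem (h : IsHierarchy o F) : ({o}ᶜ : Finset (Fin n)) ∉ F := fun hI => h.ne_compl hI rfl

lemma cluster_subset (h : IsHierarchy o F) {A : Finset (Fin n)} (hA : A ∈ clusters o F) :
    A ⊆ {o}ᶜ := by
  rcases mem_clusters.1 hA with rfl | hA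
  · rfl
  · exact subset_compl_singleton_iff.2 (h.base_notMem A hA)

lemma cluster_one_lt_card (h : IsHierarchy o F) (hn : 3 ≤ n) {A : Finset (Fin n)}
    (hA : A ∈ clusters o F) : 1 < A.card := by
  rcases mem_clusters.1 hA with rfl | hA
  · rw [card_compl_singleton]; omega
  · exact h.one_lt_card A hA

lemma cluster_nested (h : IsHierarchy o F) {A B : Finset (Fin n)} (hA : A ∈ clusters o F)
    (hB : B ∈ clusters o F) : A ⊆ B ∨ B ⊆ A ∨ Disjoint A B := by
  rcases mem_clusters.1 hA with rfl | hA'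
  · exact Or.inr (Or.inl (h.cluster_subset hB))
  · rcases mem_clusters.1 hB with rfl | hB'
    · exact Or.inl (h.cluster_subset hA)
    · exact h.nested A hA' B hB'

lemma cluster_chain (h : IsHierarchy o F) {A B : Finset (Fin n)} (hA : A ∈ clusters o F)
    (hB : B ∈ clusters o F) {i : Fin n} (hiA : i ∈ A) (hiB : i ∈ B) : A ⊆ B ∨ B ⊆ A := by
  rcases h.cluster_nested hA hB with h | h | h
  · exact Or.inl h
  · exact Or.inr h
  · exact absurd hiB (Finset.disjoint_left.1 h hiA)

/-- The clusters that contain a given non-empty set form a chain, so `parent` is one of them. -/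
lemma parent_spec (h : IsHierarchy o F) {A : Finset (Fin n)} (hA : A.Nonempty) (hAo : A ⊂ {o}ᶜ) :
    parent o F A ∈ clusters o F ∧ A ⊂ parent o F A ∧
      ∀ C ∈ clusters o F, A ⊂ C → parent o F A ⊆ C := by
  obtain ⟨P, hP, hmin⟩ := Finset.exists_min_image ((clusters o F).filter (A ⊂ ·)) Finset.card
    ⟨{o}ᶜ, Finset.mem_filter.2 ⟨Finset.mem_insert_self _ _, hAo⟩⟩
  obtain ⟨hP1, hP2⟩ := Finset.mem_filter.1 hP
  obtain ⟨i, hi⟩ := hA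
  have hle : ∀ C ∈ clusters o F, A ⊂ C → P ⊆ C := by
    intro C hC hAC
    rcases h.cluster_chain hP1 hC (hP2.1 hi) (hAC.1 hi) with h1 | h1
    · exact h1
    · exact (Finset.eq_of_subset_of_card_le h1
        (hmin C (Finset.mem_filter.2 ⟨hC, hAC⟩))).symm.subset
  have hPeq : parent o F A = P := by
    apply le_antisymm
    · exact Finset.inf_le (f := id) hP
    · refine Finset.le_inf fun C hC => ?_
      obtain ⟨hC1, hC2⟩ := Finset.mem_filter.1 hC
      exact hle C hC1 hC2
  rw [hPeq]
  exact ⟨hP1, hP2, hle⟩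

/-- Characterization of the parent. -/
lemma parent_eq (h : IsHierarchy o F) {A P : Finset (Fin n)} (hA : A.Nonempty)
    (hP : P ∈ clusters o F) (hAP : A ⊂ P) (hmin : ∀ C ∈ clusters o F, A ⊂ C → P ⊆ C) :
    parent o F A = P := by
  obtain ⟨h1, h2, h3⟩ := h.parent_spec hA (hAP.trans_subset (h.cluster_subset hP))
  exact (h3 P hP hAP).antisymm (hmin _ h1 h2)

lemma ssubset_compl (h : IsHierarchy o F) {I : Finset (Fin n)} (hI : I ∈ F) : I ⊂ {o}ᶜ :=
  (h.cluster_subset (Finset.mem_insert_of_mem hI)).ssubset_of_ne (h.ne_compl hI)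

lemma nonempty (h : IsHierarchy o F) {I : Finset (Fin n)} (hI : I ∈ F) : I.Nonempty :=
  Finset.card_pos.1 (by have := h.one_lt_card I hI; omega)

end IsHierarchy

/-! ### Split coordinates along a hierarchy -/

/-- In every set `I` of at least two labels there are two labels such that a cluster contains both
only if it contains `I`: one inside and one outside of a cluster with a maximal trace on `I`. -/
lemma IsHierarchy.exists_separated (h : IsHierarchy o F) {I : Finset (Fin n)} (hI : 1 < I.card) :
    ∃ i ∈ I, ∃ j ∈ I, i ≠ j ∧ ∀ J ∈ F, i ∈ J → j ∈ J → I ⊆ J := by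
  by_cases hex : (F.filter fun J => (J ∩ I).Nonempty ∧ ¬ I ⊆ J).Nonempty
  · obtain ⟨J, hJ, hmax⟩ := Finset.exists_max_image _ (fun J => (J ∩ I).card) hex
    simp only [Finset.mem_filter] at hJ hmax
    obtain ⟨hJF, ⟨i, hi⟩, hIJ⟩ := hJ
    obtain ⟨j, hjI, hjJ⟩ := Finset.not_subset.1 hIJ
    obtain ⟨hiJ, hiI⟩ := Finset.mem_inter.1 hi
    refine ⟨i, hiI, j, hjI, fun e => hjJ (e ▸ hiJ), fun K hK hiK hjK => ?_⟩
    by_contra hIK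
    have hJK : J ⊆ K := by
      rcases h.cluster_chain (Finset.mem_insert_of_mem hJF) (Finset.mem_insert_of_mem hK) hiJ hiK
        with h1 | h1
      · exact h1
      · exact absurd (h1 hjK) hjJ
    have hlt : (J ∩ I).card < (K ∩ I).card := by
      refine Finset.card_lt_card ⟨Finset.inter_subset_inter_right hJK, fun hs => hjJ ?_⟩
      exact (Finset.mem_inter.1 (hs (Finset.mem_inter.2 ⟨hjK, hjI⟩))).1
    have := hmax K ⟨hK, ⟨i, Finset.mem_inter.2 ⟨hiK, hiI⟩⟩, hIK⟩
    omega
  · obtain ⟨i, hi, j, hj, hij⟩ := Finset.one_lt_card.1 hI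
    refine ⟨i, hi, j, hj, hij, fun J hJ hiJ _ => ?_⟩
    by_contra hIJ
    exact hex ⟨J, Finset.mem_filter.2 ⟨hJ, ⟨i, Finset.mem_inter.2 ⟨hiJ, hi⟩⟩, hIJ⟩⟩

/-- The form `g_{ij} - g_{ik}` for the Gromov products `g`, provided that `i, j, k, o` are such
that it makes sense, and `0` otherwise. -/
noncomputable def quartetForm (o i j k : Fin n) : Module.Dual ℝ (Q n) :=
  if h : i ≠ j ∧ i ≠ k ∧ i ≠ o ∧ j ≠ o ∧ k ≠ o then
    gromovDiff (.mk h.1 h.2.2.1 h.2.2.2.1) (.mk h.2.1 h.2.2.1 h.2.2.2.2) else 0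

lemma quartetForm_integral (o i j k : Fin n) :
    IsIntegralForm (splitLattice n) (quartetForm o i j k) := by
  unfold quartetForm
  split_ifs
  · exact gromovDiff_integral _ _
  · exact fun x _ => ⟨0, by simp⟩

lemma quartetForm_splitVec {i j k : Fin n} (hij : i ≠ j) (hik : i ≠ k) (hi : i ≠ o) (hj : j ≠ o)
    (hk : k ≠ o) {J : Finset (Fin n)} (ho : o ∉ J) :
    quartetForm o i j k (splitVec J) =
      (if i ∈ J ∧ j ∈ J then 1 else 0) - if i ∈ J ∧ k ∈ J then 1 else 0 := by
  have hmk : ∀ {a b : Fin n} (h1 : a ≠ b) (h2 : a ≠ o) (h3 : b ≠ o),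
      (BasedPair.mk h1 h2 h3).1.toFinset ⊆ J ↔ a ∈ J ∧ b ∈ J := by
    intro a b _ _ _
    simp [BasedPair.mk, Sym2.toFinset_mk_eq, Finset.insert_subset_iff]
  rw [quartetForm, dif_pos ⟨hij, hik, hi, hj, hk⟩, gromovDiff_splitVec _ _ ho]
  rw [if_congr (hmk _ _ _) rfl rfl, if_congr (hmk _ _ _) rfl rfl]

/-- The coordinate of `v_I` along a hierarchy that contains `I` is a quartet form: `i` and `j` are
two labels in `I` separated by all smaller clusters, and `k` belongs to all larger clusters, but
not to `I`. -/
lemma IsHierarchy.exists_dual_form (h : IsHierarchy o F) {I : Finset (Fin n)} (hI : I ∈ F) :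
    ∃ f : Module.Dual ℝ (Q n), IsIntegralForm (splitLattice n) f ∧
      ∀ J ∈ F, f (splitVec J) = if I = J then 1 else 0 := by
  obtain ⟨i, hi, j, hj, hij, hsep⟩ := h.exists_separated (h.one_lt_card I hI)
  obtain ⟨hP, hIP, hmin⟩ := h.parent_spec (h.nonempty hI) (h.ssubset_compl hI)
  obtain ⟨k, hkP, hkI⟩ := Finset.exists_of_ssubset hIP
  have hIo := h.base_notMem I hI
  have hio : i ≠ o := fun e => hIo (e ▸ hi)
  have hjo : j ≠ o := fun e => hIo (e ▸ hj)
  have hko : k ≠ o := fun e => subset_compl_singleton_iff.1 (h.cluster_subset hP) (e ▸ hkP)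
  have hik : i ≠ k := fun e => hkI (e ▸ hi)
  refine ⟨quartetForm o i j k, quartetForm_integral _ _ _ _, fun J hJ => ?_⟩
  rw [quartetForm_splitVec hij hik hio hjo hko (h.base_notMem J hJ)]
  have h1 : (i ∈ J ∧ j ∈ J) ↔ I ⊆ J := ⟨fun hh => hsep J hJ hh.1 hh.2, fun hh => ⟨hh hi, hh hj⟩⟩
  have h2 : (i ∈ J ∧ k ∈ J) ↔ I ⊂ J := by
    constructor
    · rintro ⟨hiJ, hkJ⟩
      rcases h.cluster_chain (Finset.mem_insert_of_mem hI) (Finset.mem_insert_of_mem hJ) hi hiJ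
        with h3 | h3
      · exact h3.ssubset_of_not_subset fun h4 => hkI (h4 hkJ)
      · exact absurd (h3 hkJ) hkI
    · intro hIJ
      exact ⟨hIJ.1 hi, hmin J (Finset.mem_insert_of_mem hJ) hIJ hkP⟩
  rw [if_congr h1 rfl rfl, if_congr h2 rfl rfl]
  by_cases he : I = J
  · subst he; simp
  · by_cases hs : I ⊆ J
    · simp [hs, he, hs.ssubset_of_ne he]
    · rw [if_neg hs, if_neg fun hh => hs hh.1, if_neg he, sub_zero]

lemma IsHierarchy.exists_isUnimodular (h : IsHierarchy o F) :
    ∃ f, IsUnimodular (splitLattice n) splitVec F f := by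
  choose! f hf using fun I (hI : I ∈ F) => h.exists_dual_form hI
  exact ⟨f, fun I hI => splitVec_mem (h.one_lt_card I hI) (h.card_lt I hI),
    fun I hI => (hf I hI).1, fun I hI J hJ => (hf I hI).2 J hJ⟩

/-- A positive combination of the split vectors of a hierarchy determines the hierarchy: its
members are the splits for which all quartet forms are positive. -/
lemma IsHierarchy.mem_iff (h : IsHierarchy o F) {c : Finset (Fin n) → ℝ} (hc : ∀ J ∈ F, 0 < c J)
    {I : Finset (Fin n)} (hIo : o ∉ I) (h1 : 1 < I.card) (h2 : I.card + 1 < n) :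
    I ∈ F ↔ ∀ i ∈ I, ∀ j ∈ I, ∀ k ∉ I, i ≠ j → k ≠ o →
      0 < quartetForm o i j k (∑ J ∈ F, c J • splitVec J) := by
  have hval : ∀ i ∈ I, ∀ j ∈ I, ∀ k ∉ I, i ≠ j → k ≠ o →
      quartetForm o i j k (∑ J ∈ F, c J • splitVec J) =
        ∑ J ∈ F, c J * ((if i ∈ J ∧ j ∈ J then 1 else 0) - if i ∈ J ∧ k ∈ J then 1 else 0) := by
    intro i hi j hj k hk hij hko
    rw [map_sum]
    refine Finset.sum_congr rfl fun J hJ => ?_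
    rw [map_smul, quartetForm_splitVec hij (by rintro rfl; exact hk hi) (by rintro rfl; exact hIo hi)
      (by rintro rfl; exact hIo hj) hko (h.base_notMem J hJ), smul_eq_mul]
  constructor
  · intro hI i hi j hj k hk hij hko
    rw [hval i hi j hj k hk hij hko]
    refine Finset.sum_pos' (fun J hJ => mul_nonneg (hc J hJ).le ?_) ⟨I, hI, ?_⟩
    · by_cases hJ' : i ∈ J ∧ k ∈ J
      · have : I ⊆ J := by
          rcases h.cluster_chain (Finset.mem_insert_of_mem hI) (Finset.mem_insert_of_mem hJ) hi
            hJ'.1 with h3 | h3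
          · exact h3
          · exact absurd (h3 hJ'.2) hk
        simp [hJ', this hj]
      · rw [if_neg hJ', sub_zero]; split_ifs <;> simp
    · simpa [hi, hj, hk] using hc I hI
  · intro hpos
    by_contra hI
    obtain ⟨i, hi, j, hj, hij, hsep⟩ := h.exists_separated h1
    have hIne : I.Nonempty := ⟨i, hi⟩
    have hIss : I ⊂ {o}ᶜ := by
      refine (subset_compl_singleton_iff.2 hIo).ssubset_of_ne fun e => ?_
      rw [e, card_compl_singleton] at h2
      omega
    obtain ⟨hP, hIP, hmin⟩ := h.parent_spec hIne hIss
    obtain ⟨k, hkP, hkI⟩ := Finset.exists_of_ssubset hIP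
    have hko : k ≠ o := fun e => subset_compl_singleton_iff.1 (h.cluster_subset hP) (e ▸ hkP)
    have := hpos i hi j hj k hkI hij hko
    rw [hval i hi j hj k hkI hij hko] at this
    refine absurd this (not_lt.2 (Finset.sum_nonpos fun J hJ => ?_))
    refine mul_nonpos_of_nonneg_of_nonpos (hc J hJ).le ?_
    by_cases hJ' : i ∈ J ∧ j ∈ J
    · have hIJ := hsep J hJ hJ'.1 hJ'.2
      have hkJ := hmin J (Finset.mem_insert_of_mem hJ)
        (hIJ.ssubset_of_ne fun e => hI (e ▸ hJ)) hkP
      simp [hJ', hkJ]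
    · rw [if_neg hJ']; split_ifs <;> simp

lemma IsHierarchy.eq_of_sum_eq {F' : Finset (Finset (Fin n))} (h : IsHierarchy o F)
    (h' : IsHierarchy o F') {c c' : Finset (Fin n) → ℝ} (hc : ∀ J ∈ F, 0 < c J)
    (hc' : ∀ J ∈ F', 0 < c' J)
    (heq : ∑ J ∈ F, c J • splitVec J = ∑ J ∈ F', c' J • splitVec J) :
    F = F' ∧ ∀ J ∈ F, c J = c' J := by
  have hF : F = F' := by
    ext I
    by_cases hI : o ∉ I ∧ 1 < I.card ∧ I.card + 1 < n
    · rw [h.mem_iff hc hI.1 hI.2.1 hI.2.2, h'.mem_iff hc' hI.1 hI.2.1 hI.2.2, heq]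
    · exact ⟨fun hh => absurd ⟨h.base_notMem I hh, h.one_lt_card I hh, h.card_lt I hh⟩ hI,
        fun hh => absurd ⟨h'.base_notMem I hh, h'.one_lt_card I hh, h'.card_lt I hh⟩ hI⟩
  subst hF
  obtain ⟨f, hf⟩ := h.exists_isUnimodular
  refine ⟨rfl, fun J hJ => ?_⟩
  rw [← hf.apply_sum hJ c, heq, hf.apply_sum hJ c']

/-- The cone of a hierarchy: the non-negative combinations of its split vectors. -/
abbrev hierarchyCone (F : Finset (Finset (Fin n))) : Set (Q n) := finCone splitVec F

/-- Every point of the cone of `F` is a positive combination along a subset of `F`. -/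
lemma exists_support {x : Q n} (hx : x ∈ hierarchyCone F) :
    ∃ F' ⊆ F, ∃ c : Finset (Fin n) → ℝ, (∀ J ∈ F', 0 < c J) ∧ x = ∑ J ∈ F', c J • splitVec J := by
  obtain ⟨c, hc, rfl⟩ := hx
  refine ⟨F.filter (c · ≠ 0), Finset.filter_subset _ _, c, fun J hJ => ?_, ?_⟩
  · obtain ⟨h1, h2⟩ := Finset.mem_filter.1 hJ
    exact (hc J h1).lt_of_ne' h2
  · rw [Finset.sum_filter]
    refine Finset.sum_congr rfl fun J _ => ?_
    split_ifs with h0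
    · rfl
    · rw [not_not.1 h0, zero_smul]

lemma IsHierarchy.inter {F' : Finset (Finset (Fin n))} (h : IsHierarchy o F)
    (h' : IsHierarchy o F') :
    hierarchyCone F ∩ hierarchyCone F' = hierarchyCone (F ∩ F') := by
  apply Set.Subset.antisymm
  · rintro x ⟨hx, hx'⟩
    obtain ⟨G, hG, c, hc, rfl⟩ := exists_support hx
    obtain ⟨G', hG', c', hc', heq⟩ := exists_support hx'
    obtain ⟨rfl, -⟩ := (h.subset hG).eq_of_sum_eq (h'.subset hG') hc hc' heq
    exact finCone_mono (Finset.subset_inter hG hG') ⟨c, fun J hJ => (hc J hJ).le, rfl⟩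
  · exact Set.subset_inter (finCone_mono Finset.inter_subset_left)
      (finCone_mono Finset.inter_subset_right)

lemma IsHierarchy.cone_subset_iff {F' : Finset (Finset (Fin n))} (h : IsHierarchy o F)
    (h' : IsHierarchy o F') : hierarchyCone F ⊆ hierarchyCone F' ↔ F ⊆ F' := by
  refine ⟨fun hs => ?_, finCone_mono⟩
  have hx : ∑ J ∈ F, (1 : ℝ) • splitVec J ∈ hierarchyCone F := ⟨fun _ => 1, by simp, rfl⟩
  obtain ⟨G', hG', c', hc', heq⟩ := exists_support (hs hx)
  obtain ⟨rfl, -⟩ := h.eq_of_sum_eq (h'.subset hG') (c := fun _ => 1) (by simp) hc' heq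
  exact hG'

lemma IsHierarchy.cone_inj {F' : Finset (Finset (Fin n))} (h : IsHierarchy o F)
    (h' : IsHierarchy o F') (heq : hierarchyCone F = hierarchyCone F') : F = F' :=
  ((h.cone_subset_iff h').1 heq.subset).antisymm ((h'.cone_subset_iff h).1 heq.superset)

end Hierarchies

/-! ### The children of a cluster -/

section Parts

variable {n : ℕ} {o : Fin n} {F : Finset (Finset (Fin n))}

/-- The members of `F` and the singletons other than `{o}`. These are the directions in which one
can leave a vertex of the tree of `F` away from the end `o`: along a bounded edge or an end. -/
def branches (o : Fin n) (F : Finset (Finset (Fin n))) : Finset (Finset (Fin n)) :=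
  F ∪ ({o}ᶜ : Finset (Fin n)).image singleton

/-- The branches of `F` that start at the vertex `A` of the tree of `F`. -/
def parts (o : Fin n) (F : Finset (Finset (Fin n))) (A : Finset (Fin n)) :
    Finset (Finset (Fin n)) :=
  (branches o F).filter (parent o F · = A)

lemma mem_branches {B : Finset (Fin n)} : B ∈ branches o F ↔ B ∈ F ∨ ∃ i, i ≠ o ∧ {i} = B := by
  simp [branches]

lemma mem_parts {A B : Finset (Fin n)} : B ∈ parts o F A ↔ B ∈ branches o F ∧ parent o F B = A :=
  Finset.mem_filter

namespace IsHierarchy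

lemma branch_nonempty (h : IsHierarchy o F) {B : Finset (Fin n)} (hB : B ∈ branches o F) :
    B.Nonempty := by
  rcases mem_branches.1 hB with hB | ⟨i, -, rfl⟩
  · exact h.nonempty hB
  · simp

lemma branch_ssubset (h : IsHierarchy o F) (hn : 3 ≤ n) {B : Finset (Fin n)}
    (hB : B ∈ branches o F) : B ⊂ {o}ᶜ := by
  rcases mem_branches.1 hB with hB | ⟨i, hi, rfl⟩
  · exact h.ssubset_compl hB
  · refine (subset_compl_singleton_iff.2 (by simpa using hi.symm)).ssubset_of_ne fun e => ?_
    have := congrArg Finset.card e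
    rw [card_compl_singleton, Finset.card_singleton] at this
    omega

lemma branch_parent_spec (h : IsHierarchy o F) (hn : 3 ≤ n) {B : Finset (Fin n)}
    (hB : B ∈ branches o F) : parent o F B ∈ clusters o F ∧ B ⊂ parent o F B ∧
      ∀ C ∈ clusters o F, B ⊂ C → parent o F B ⊆ C :=
  h.parent_spec (h.branch_nonempty hB) (h.branch_ssubset hn hB)

lemma branch_chain (h : IsHierarchy o F) {B B' : Finset (Fin n)} (hB : B ∈ branches o F)
    (hB' : B' ∈ branches o F) {i : Fin n} (hi : i ∈ B) (hi' : i ∈ B') : B ⊆ B' ∨ B' ⊆ B := by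
  rcases mem_branches.1 hB with hB | ⟨j, -, rfl⟩
  · rcases mem_branches.1 hB' with hB' | ⟨k, -, rfl⟩
    · exact h.cluster_chain (Finset.mem_insert_of_mem hB) (Finset.mem_insert_of_mem hB') hi hi'
    · right
      rw [Finset.mem_singleton] at hi'
      rw [← hi']
      simpa using hi
  · left
    rw [Finset.mem_singleton] at hi
    rw [← hi]
    simpa using hi'

lemma part_ssubset (h : IsHierarchy o F) (hn : 3 ≤ n) {A B : Finset (Fin n)}
    (hB : B ∈ parts o F A) : B ⊂ A := by
  obtain ⟨hB', rfl⟩ := mem_parts.1 hB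
  exact (h.branch_parent_spec hn hB').2.1

lemma part_nonempty (h : IsHierarchy o F) {A B : Finset (Fin n)} (hB : B ∈ parts o F A) :
    B.Nonempty := h.branch_nonempty (mem_parts.1 hB).1

lemma subset_of_part_ssubset (h : IsHierarchy o F) (hn : 3 ≤ n) {A B C : Finset (Fin n)}
    (hB : B ∈ parts o F A) (hC : C ∈ clusters o F) (hBC : B ⊂ C) : A ⊆ C := by
  obtain ⟨hB', rfl⟩ := mem_parts.1 hB
  exact (h.branch_parent_spec hn hB').2.2 C hC hBC

/-- A branch that strictly contains a non-empty set is not a singleton. -/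
lemma branch_mem_of_ssubset {B B' : Finset (Fin n)} (hB : B.Nonempty)
    (hB' : B' ∈ branches o F) (hBB' : B ⊂ B') : B' ∈ F := by
  rcases mem_branches.1 hB' with hB' | ⟨i, -, rfl⟩
  · exact hB'
  · have h1 := Finset.card_lt_card hBB'
    have h2 := hB.card_pos
    rw [Finset.card_singleton] at h1
    omega

lemma exists_part (h : IsHierarchy o F) (hn : 3 ≤ n) {A : Finset (Fin n)}
    (hA : A ∈ clusters o F) {x : Fin n} (hx : x ∈ A) : ∃ B ∈ parts o F A, x ∈ B := by
  have hxo : x ≠ o := by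
    rintro rfl
    exact subset_compl_singleton_iff.1 (h.cluster_subset hA) hx
  have hxA : ({x} : Finset (Fin n)) ⊂ A := by
    refine (Finset.singleton_subset_iff.2 hx).ssubset_of_ne fun e => ?_
    have := h.cluster_one_lt_card hn hA
    rw [← e, Finset.card_singleton] at this
    omega
  obtain ⟨B, hB, hmax⟩ := Finset.exists_max_image
    ((branches o F).filter fun B => x ∈ B ∧ B ⊂ A) Finset.card
    ⟨{x}, Finset.mem_filter.2 ⟨mem_branches.2 (Or.inr ⟨x, hxo, rfl⟩), by simp, hxA⟩⟩
  obtain ⟨hB, hxB, hBA⟩ := Finset.mem_filter.1 hB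
  obtain ⟨h1, h2, h3⟩ := h.branch_parent_spec hn hB
  refine ⟨B, mem_parts.2 ⟨hB, ?_⟩, hxB⟩
  by_contra hne
  have hPA : parent o F B ⊂ A := (h3 A hA hBA).ssubset_of_ne hne
  have hPF : parent o F B ∈ F := by
    rcases mem_clusters.1 h1 with he | he
    · exact absurd (hPA.trans_subset (h.cluster_subset hA)) (by rw [he]; exact ssubset_irrefl _)
    · exact he
  have := hmax _ (Finset.mem_filter.2
    ⟨mem_branches.2 (Or.inl hPF), h2.1 hxB, hPA⟩)
  have := Finset.card_lt_card h2
  omega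

lemma parts_disjoint (h : IsHierarchy o F) (hn : 3 ≤ n) {A B B' : Finset (Fin n)}
    (hB : B ∈ parts o F A) (hB' : B' ∈ parts o F A) (hne : B ≠ B') : Disjoint B B' := by
  have key : ∀ {B B' : Finset (Fin n)}, B ∈ parts o F A → B' ∈ parts o F A → ¬ B ⊂ B' := by
    intro B B' hB hB' hs
    have hF := branch_mem_of_ssubset (h.part_nonempty hB) (mem_parts.1 hB').1 hs
    have := h.subset_of_part_ssubset hn hB (Finset.mem_insert_of_mem hF) hs
    exact (h.part_ssubset hn hB').not_subset this
  rw [Finset.disjoint_left]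
  intro i hi hi'
  rcases h.branch_chain (mem_parts.1 hB).1 (mem_parts.1 hB').1 hi hi' with h1 | h1
  · exact key hB hB' (h1.ssubset_of_ne hne)
  · exact key hB' hB (h1.ssubset_of_ne hne.symm)

lemma two_le_card_parts (h : IsHierarchy o F) (hn : 3 ≤ n) {A : Finset (Fin n)}
    (hA : A ∈ clusters o F) : 2 ≤ (parts o F A).card := by
  obtain ⟨x, hx⟩ : A.Nonempty := Finset.card_pos.1 (by have := h.cluster_one_lt_card hn hA; omega)
  obtain ⟨B, hB, -⟩ := h.exists_part hn hA hx
  obtain ⟨y, hyA, hyB⟩ := Finset.exists_of_ssubset (h.part_ssubset hn hB)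
  obtain ⟨B', hB', hy⟩ := h.exists_part hn hA hyA
  exact Finset.one_lt_card.2 ⟨B, hB, B', hB', fun e => hyB (e ▸ hy)⟩

/-- Every branch starts at exactly one vertex. -/
lemma sum_card_parts (h : IsHierarchy o F) (hn : 3 ≤ n) :
    ∑ A ∈ clusters o F, (parts o F A).card = F.card + (n - 1) := by
  rw [← card_compl_singleton o,
    ← Finset.card_image_of_injective ({o}ᶜ : Finset (Fin n)) Finset.singleton_injective,
    ← Finset.card_union_of_disjoint]
  · exact (Finset.card_eq_sum_card_fiberwise (f := parent o F) (s := branches o F)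
      (t := clusters o F) fun B hB => (h.branch_parent_spec hn hB).1).symm
  · rw [Finset.disjoint_right]
    intro B hB hB'
    obtain ⟨i, -, rfl⟩ := Finset.mem_image.1 hB
    simpa using h.one_lt_card _ hB'

lemma card_clusters (h : IsHierarchy o F) : (clusters o F).card = F.card + 1 :=
  Finset.card_insert_of_notMem h.top_notMem

lemma card_add_three_le (h : IsHierarchy o F) (hn : 3 ≤ n) : F.card + 3 ≤ n := by
  have h1 := h.sum_card_parts hn
  have h2 : (clusters o F).card • 2 ≤ ∑ A ∈ clusters o F, (parts o F A).card :=
    Finset.card_nsmul_le_sum _ _ _ fun A hA => h.two_le_card_parts hn hA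
  rw [h.card_clusters, smul_eq_mul] at h2
  omega

lemma exists_three_le_card_parts (h : IsHierarchy o F) (hn : 3 ≤ n) (hF : F.card + 3 < n) :
    ∃ A ∈ clusters o F, 3 ≤ (parts o F A).card := by
  by_contra! hlt
  have h1 := h.sum_card_parts hn
  have h2 : ∑ A ∈ clusters o F, (parts o F A).card ≤ (clusters o F).card • 2 :=
    Finset.sum_le_card_nsmul _ _ _ fun A hA => Nat.le_of_lt_succ (hlt A hA)
  rw [h.card_clusters, smul_eq_mul] at h2
  omega

/-- If only one split is missing, one vertex has valence four and all others are trivalent. -/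
lemma exists_card_parts_eq_three (h : IsHierarchy o F) (hn : 3 ≤ n) (hF : F.card + 4 = n) :
    ∃ A ∈ clusters o F, (parts o F A).card = 3 ∧
      ∀ A' ∈ clusters o F, A' ≠ A → (parts o F A').card = 2 := by
  obtain ⟨A, hA, hA3⟩ := h.exists_three_le_card_parts hn (by omega)
  have h1 := h.sum_card_parts hn
  rw [← Finset.add_sum_erase _ _ hA] at h1
  have hc : ((clusters o F).erase A).card = F.card := by
    rw [Finset.card_erase_of_mem hA, h.card_clusters, Nat.add_sub_cancel]
  have h2 : ((clusters o F).erase A).card • 2 ≤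
      ∑ A ∈ (clusters o F).erase A, (parts o F A).card :=
    Finset.card_nsmul_le_sum _ _ _ fun A hA => h.two_le_card_parts hn (Finset.mem_of_mem_erase hA)
  rw [hc, smul_eq_mul] at h2
  refine ⟨A, hA, by omega, fun A' hA' hne => ?_⟩
  have hA'' := Finset.mem_erase.2 ⟨hne, hA'⟩
  have h3 : (((clusters o F).erase A).erase A').card • 2 ≤
      ∑ A ∈ ((clusters o F).erase A).erase A', (parts o F A).card :=
    Finset.card_nsmul_le_sum _ _ _ fun A hA =>
      h.two_le_card_parts hn (Finset.mem_of_mem_erase (Finset.mem_of_mem_erase hA))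
  rw [← Finset.add_sum_erase _ _ hA''] at h1
  rw [Finset.card_erase_of_mem hA'', hc, smul_eq_mul] at h3
  have h4 := h.two_le_card_parts hn hA'
  have h5 : 0 < ((clusters o F).erase A).card := Finset.card_pos.2 ⟨A', hA''⟩
  omega

/-! ### Adding one split to a hierarchy -/

/-- The union of two of at least three branches at a vertex is compatible with the hierarchy. -/
lemma insert_union (h : IsHierarchy o F) (hn : 3 ≤ n) {A B₁ B₂ : Finset (Fin n)}
    (hA : A ∈ clusters o F) (hA3 : 3 ≤ (parts o F A).card) (h₁ : B₁ ∈ parts o F A)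
    (h₂ : B₂ ∈ parts o F A) (hne : B₁ ≠ B₂) :
    B₁ ∪ B₂ ∉ F ∧ IsHierarchy o (insert (B₁ ∪ B₂) F) := by
  obtain ⟨B₃, h₃, hB₃⟩ : ∃ B ∈ parts o F A, B ∉ ({B₁, B₂} : Finset (Finset (Fin n))) :=
    Finset.exists_mem_notMem_of_card_lt_card ((Finset.card_le_two).trans_lt hA3)
  simp only [Finset.mem_insert, Finset.mem_singleton, not_or] at hB₃
  have hd := h.parts_disjoint hn h₁ h₂ hne
  have hIA : B₁ ∪ B₂ ⊂ A := by
    refine ⟨Finset.union_subset (h.part_ssubset hn h₁).1 (h.part_ssubset hn h₂).1, fun hs => ?_⟩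
    obtain ⟨x, hx⟩ := h.part_nonempty h₃
    rcases Finset.mem_union.1 (hs ((h.part_ssubset hn h₃).1 hx)) with hx' | hx'
    · exact Finset.disjoint_left.1 (h.parts_disjoint hn h₃ h₁ hB₃.1) hx hx'
    · exact Finset.disjoint_left.1 (h.parts_disjoint hn h₃ h₂ hB₃.2) hx hx'
  have hIo : o ∉ B₁ ∪ B₂ :=
    subset_compl_singleton_iff.1 (hIA.1.trans (h.cluster_subset hA))
  have hI1 : 1 < (B₁ ∪ B₂).card := by
    rw [Finset.card_union_of_disjoint hd]
    have := (h.part_nonempty h₁).card_pos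
    have := (h.part_nonempty h₂).card_pos
    omega
  have hI2 : (B₁ ∪ B₂).card + 1 < n := by
    have := Finset.card_lt_card (hIA.trans_subset (h.cluster_subset hA))
    rw [card_compl_singleton] at this
    omega
  have hnest : ∀ J ∈ F, B₁ ∪ B₂ ⊆ J ∨ J ⊆ B₁ ∪ B₂ ∨ Disjoint (B₁ ∪ B₂) J := by
    intro J hJ
    rcases h.cluster_nested hA (Finset.mem_insert_of_mem hJ) with h4 | h4 | h4
    · exact Or.inl (hIA.1.trans h4)
    · by_cases hJA : J = A
      · exact Or.inl (hJA ▸ hIA.1)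
      · obtain ⟨x, hx⟩ := h.nonempty hJ
        obtain ⟨B, hB, hxB⟩ := h.exists_part hn hA (h4 hx)
        have hJB : J ⊆ B := by
          rcases h.branch_chain (mem_parts.1 hB).1 (mem_branches.2 (Or.inl hJ)) hxB hx with h5 | h5
          · by_cases hBJ : B = J
            · exact hBJ.symm.subset
            · exact absurd (h4.antisymm (h.subset_of_part_ssubset hn hB
                (Finset.mem_insert_of_mem hJ) (h5.ssubset_of_ne hBJ))) hJA
          · exact h5
        by_cases hB1 : B = B₁
        · exact Or.inr (Or.inl (hJB.trans (hB1 ▸ Finset.subset_union_left)))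
        by_cases hB2 : B = B₂
        · exact Or.inr (Or.inl (hJB.trans (hB2 ▸ Finset.subset_union_right)))
        refine Or.inr (Or.inr (Finset.disjoint_of_subset_right hJB ?_))
        exact Finset.disjoint_union_left.2 ⟨h.parts_disjoint hn h₁ hB (Ne.symm hB1),
          h.parts_disjoint hn h₂ hB (Ne.symm hB2)⟩
    · exact Or.inr (Or.inr (Finset.disjoint_of_subset_left hIA.1 h4))
  refine ⟨fun hI => ?_, ⟨?_, ?_, ?_, ?_⟩⟩
  · have hss : B₁ ⊂ B₁ ∪ B₂ := by
      refine ⟨Finset.subset_union_left, fun hs => ?_⟩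
      obtain ⟨x, hx⟩ := h.part_nonempty h₂
      exact Finset.disjoint_left.1 hd (hs (Finset.mem_union_right _ hx)) hx
    exact hIA.2 (h.subset_of_part_ssubset hn h₁ (Finset.mem_insert_of_mem hI) hss)
  · simpa only [Finset.forall_mem_insert] using ⟨hIo, h.base_notMem⟩
  · simpa only [Finset.forall_mem_insert] using ⟨hI1, h.one_lt_card⟩
  · simpa only [Finset.forall_mem_insert] using ⟨hI2, h.card_lt⟩
  · intro J hJ K hK
    rcases Finset.mem_insert.1 hJ with rfl | hJ
    · rcases Finset.mem_insert.1 hK with rfl | hK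
      · exact Or.inl subset_rfl
      · exact hnest K hK
    · rcases Finset.mem_insert.1 hK with rfl | hK
      · rcases hnest J hJ with h4 | h4 | h4
        · exact Or.inr (Or.inl h4)
        · exact Or.inl h4
        · exact Or.inr (Or.inr h4.symm)
      · exact h.nested J hJ K hK

/-- Conversely, a compatible new split `I` is a union of at least two, but not all, branches at
the vertex `parent o F I`. -/
lemma exists_parts_of_insert (h : IsHierarchy o F) (hn : 3 ≤ n) {I : Finset (Fin n)} (hI : I ∉ F)
    (hIF : IsHierarchy o (insert I F)) :
    ∃ A ∈ clusters o F, ∃ P ⊂ parts o F A, 2 ≤ P.card ∧ I = P.biUnion id := by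
  have hII : I ∈ insert I F := Finset.mem_insert_self _ _
  have hIne := hIF.nonempty hII
  obtain ⟨hA, hIA, hmin⟩ := h.parent_spec hIne (hIF.ssubset_compl hII)
  set A := parent o F I
  have hmeet : ∀ B ∈ parts o F A, ∀ x ∈ B, x ∈ I → B ⊆ I := by
    intro B hB x hxB hxI
    rcases mem_branches.1 (mem_parts.1 hB).1 with hBF | ⟨i, -, rfl⟩
    · have hBc : B ∈ clusters o F := Finset.mem_insert_of_mem hBF
      rcases hIF.cluster_chain (Finset.mem_insert_of_mem (Finset.mem_insert_of_mem hBF))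
        (Finset.mem_insert_of_mem hII) hxB hxI with h1 | h1
      · exact h1
      · have := hmin B hBc (h1.ssubset_of_ne fun e => hI (e ▸ hBF))
        exact absurd this (h.part_ssubset hn hB).not_subset
    · rw [Finset.mem_singleton] at hxB
      simpa [← hxB] using hxI
  have hIP : I = ((parts o F A).filter (· ⊆ I)).biUnion id := by
    ext x
    simp only [Finset.mem_biUnion, Finset.mem_filter, id]
    constructor
    · intro hx
      obtain ⟨B, hB, hxB⟩ := h.exists_part hn hA (hIA.1 hx)
      exact ⟨B, ⟨hB, hmeet B hB x hxB hx⟩, hxB⟩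
    · rintro ⟨B, ⟨-, hBI⟩, hxB⟩
      exact hBI hxB
  refine ⟨A, hA, (parts o F A).filter (· ⊆ I), ?_, ?_, hIP⟩
  · refine (Finset.filter_subset _ _).ssubset_of_ne fun he => ?_
    obtain ⟨x, hxA, hxI⟩ := Finset.exists_of_ssubset hIA
    obtain ⟨B, hB, hxB⟩ := h.exists_part hn hA hxA
    rw [← he] at hB
    exact hxI ((Finset.mem_filter.1 hB).2 hxB)
  · by_contra hlt
    obtain hcard | hcard : ((parts o F A).filter (· ⊆ I)).card = 0 ∨
        ((parts o F A).filter (· ⊆ I)).card = 1 := by omega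
    · rw [Finset.card_eq_zero.1 hcard] at hIP
      exact hIne.ne_empty hIP
    · obtain ⟨B, hB⟩ := Finset.card_eq_one.1 hcard
      rw [hB, Finset.singleton_biUnion, id] at hIP
      have hBp : B ∈ parts o F A := by
        have : B ∈ (parts o F A).filter (· ⊆ I) := by rw [hB]; simp
        exact (Finset.mem_filter.1 this).1
      rcases mem_branches.1 (mem_parts.1 hBp).1 with hBF | ⟨i, -, rfl⟩
      · exact hI (hIP ▸ hBF)
      · have := hIF.one_lt_card I hII
        rw [hIP, Finset.card_singleton] at this
        omega

/-- The three hierarchies obtained by resolving the four-valent vertex. -/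
lemma exists_resolutions (h : IsHierarchy o F) (hn : 3 ≤ n) (hF : F.card + 4 = n) :
    ∃ A ∈ clusters o F, ∃ B₁ B₂ B₃, (B₁ ∈ branches o F ∧ B₂ ∈ branches o F ∧ B₃ ∈ branches o F) ∧
      (Disjoint B₁ B₂ ∧ Disjoint B₁ B₃ ∧ Disjoint B₂ B₃) ∧ A = B₁ ∪ B₂ ∪ B₃ ∧
      ∀ I, (I ∉ F ∧ IsHierarchy o (insert I F)) ↔
        I ∈ ({B₁ ∪ B₂, B₁ ∪ B₃, B₂ ∪ B₃} : Finset (Finset (Fin n))) := by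
  obtain ⟨A, hA, hA3, hA2⟩ := h.exists_card_parts_eq_three hn hF
  obtain ⟨B₁, B₂, B₃, h12, h13, h23, hp⟩ := Finset.card_eq_three.1 hA3
  have h₁ : B₁ ∈ parts o F A := by rw [hp]; simp
  have h₂ : B₂ ∈ parts o F A := by rw [hp]; simp
  have h₃ : B₃ ∈ parts o F A := by rw [hp]; simp
  refine ⟨A, hA, B₁, B₂, B₃, ⟨(mem_parts.1 h₁).1, (mem_parts.1 h₂).1, (mem_parts.1 h₃).1⟩,
    ⟨h.parts_disjoint hn h₁ h₂ h12, h.parts_disjoint hn h₁ h₃ h13,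
      h.parts_disjoint hn h₂ h₃ h23⟩, ?_, fun I => ⟨?_, ?_⟩⟩
  · apply Finset.Subset.antisymm
    · intro x hx
      obtain ⟨B, hB, hxB⟩ := h.exists_part hn hA hx
      rw [hp] at hB
      simp only [Finset.mem_insert, Finset.mem_singleton] at hB
      simp only [Finset.mem_union]
      rcases hB with rfl | rfl | rfl <;> simp [hxB]
    · exact Finset.union_subset (Finset.union_subset (h.part_ssubset hn h₁).1
        (h.part_ssubset hn h₂).1) (h.part_ssubset hn h₃).1
  · rintro ⟨hI, hIF⟩
    obtain ⟨A', hA', P, hP, hP2, rfl⟩ := h.exists_parts_of_insert hn hI hIF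
    have hlt := Finset.card_lt_card hP
    have hAA' : A' = A := by
      by_contra hne
      have := hA2 A' hA' hne
      omega
    subst hAA'
    have hP2 : P.card = 2 := by omega
    obtain ⟨C, D, hCD, rfl⟩ := Finset.card_eq_two.1 hP2
    have hC : C ∈ parts o F A' := hP.1 (by simp)
    have hD : D ∈ parts o F A' := hP.1 (by simp)
    rw [hp] at hC hD
    simp only [Finset.mem_insert, Finset.mem_singleton] at hC hD
    have hbi : ({C, D} : Finset (Finset (Fin n))).biUnion id = C ∪ D := by
      simp [Finset.biUnion_insert]
    rw [hbi]
    simp only [Finset.mem_insert, Finset.mem_singleton]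
    rcases hC with rfl | rfl | rfl <;> rcases hD with rfl | rfl | rfl <;>
      first
      | exact absurd rfl hCD
      | exact Or.inl rfl
      | exact Or.inr (Or.inl rfl)
      | exact Or.inr (Or.inr rfl)
      | exact Or.inl (Finset.union_comm _ _)
      | exact Or.inr (Or.inl (Finset.union_comm _ _))
      | exact Or.inr (Or.inr (Finset.union_comm _ _))
  · intro hI
    simp only [Finset.mem_insert, Finset.mem_singleton] at hI
    rcases hI with rfl | rfl | rfl
    · exact h.insert_union hn hA hA3.ge h₁ h₂ h12
    · exact h.insert_union hn hA hA3.ge h₁ h₃ h13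
    · exact h.insert_union hn hA hA3.ge h₂ h₃ h23

end IsHierarchy

/-- The relation behind the balancing condition: two labels from different sets `B_a`, `B_b` lie
together in `B_a ∪ B_b` and in the union of all three sets; two labels from the same `B_a` lie
together in two sets on each side. -/
lemma splitVec_union_add (hn : 3 ≤ n) {B₁ B₂ B₃ : Finset (Fin n)} (ho : o ∉ B₁ ∪ B₂ ∪ B₃)
    (h12 : Disjoint B₁ B₂) (h13 : Disjoint B₁ B₃) (h23 : Disjoint B₂ B₃) :
    splitVec (B₁ ∪ B₂) + (splitVec (B₁ ∪ B₃) + splitVec (B₂ ∪ B₃)) =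
      splitVec (B₁ ∪ B₂ ∪ B₃) + (splitVec B₁ + (splitVec B₂ + splitVec B₃)) := by
  simp only [Finset.mem_union, not_or] at ho
  obtain ⟨⟨ho1, ho2⟩, ho3⟩ := ho
  have key : ∀ e : BasedPair o, gromov o e (splitDist (B₁ ∪ B₂) +
      (splitDist (B₁ ∪ B₃) + splitDist (B₂ ∪ B₃))) = gromov o e
      (splitDist (B₁ ∪ B₂ ∪ B₃) + (splitDist B₁ + (splitDist B₂ + splitDist B₃))) := by
    rintro ⟨e, he⟩
    simp only [map_add]
    rw [gromov_splitDist, gromov_splitDist, gromov_splitDist, gromov_splitDist, gromov_splitDist,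
      gromov_splitDist, gromov_splitDist] <;> try simp [ho1, ho2, ho3]
    induction e with
    | _ i j =>
      have d12 : ∀ x ∈ B₁, x ∉ B₂ := fun x hx => Finset.disjoint_left.1 h12 hx
      have d13 : ∀ x ∈ B₁, x ∉ B₃ := fun x hx => Finset.disjoint_left.1 h13 hx
      have d23 : ∀ x ∈ B₂, x ∉ B₃ := fun x hx => Finset.disjoint_left.1 h23 hx
      simp only [Sym2.toFinset_mk_eq, Finset.insert_subset_iff, Finset.singleton_subset_iff,
        Finset.mem_union]
      have cases3 : ∀ x : Fin n, (x ∈ B₁ ∧ x ∉ B₂ ∧ x ∉ B₃) ∨ (x ∉ B₁ ∧ x ∈ B₂ ∧ x ∉ B₃) ∨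
          (x ∉ B₁ ∧ x ∉ B₂ ∧ x ∈ B₃) ∨ (x ∉ B₁ ∧ x ∉ B₂ ∧ x ∉ B₃) := by
        intro x
        have := d12 x; have := d13 x; have := d23 x
        tauto
      rcases cases3 i with ⟨a1, a2, a3⟩ | ⟨a1, a2, a3⟩ | ⟨a1, a2, a3⟩ | ⟨a1, a2, a3⟩ <;>
      rcases cases3 j with ⟨b1, b2, b3⟩ | ⟨b1, b2, b3⟩ | ⟨b1, b2, b3⟩ | ⟨b1, b2, b3⟩ <;>
      simp [a1, a2, a3, b1, b2, b3]
  obtain ⟨i, hi, j, hj, hij⟩ := Finset.one_lt_card.1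
    (show 1 < ({o}ᶜ : Finset (Fin n)).card by rw [card_compl_singleton]; omega)
  simp only [Finset.mem_compl, Finset.mem_singleton] at hi hj
  rw [← sub_eq_zero]
  refine eq_zero_of_gromovDiff_eq_zero (BasedPair.mk hij hi hj) fun e => ?_
  simp only [splitVec, ← map_add, ← map_sub]
  rw [gromovDiff_qMap, map_sub, map_sub, key, key, sub_self, sub_self, sub_self]

end Parts

/-! ### Trees of hierarchies -/

section ClusterTrees

variable {n : ℕ} {o : Fin n} {F : Finset (Finset (Fin n))} {V : Type}

/-- The vertices of the graph `G` correspond via `β` to the clusters of the hierarchy `F`, the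
edges joining each cluster to its parent. -/
structure IsClusterGraph (o : Fin n) (F : Finset (Finset (Fin n))) (G : SimpleGraph V)
    (β : V → Finset (Fin n)) : Prop where
  hierarchy : IsHierarchy o F
  injective : Function.Injective β
  range_eq : Set.range β = clusters o F
  adj_iff : ∀ x y, G.Adj x y ↔
    (β x ≠ {o}ᶜ ∧ β y = parent o F (β x)) ∨ (β y ≠ {o}ᶜ ∧ β x = parent o F (β y))

namespace IsClusterGraph

variable {G : SimpleGraph V} {β : V → Finset (Fin n)}

lemma mem (h : IsClusterGraph o F G β) (x : V) : β x ∈ clusters o F := by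
  have : β x ∈ Set.range β := ⟨x, rfl⟩
  rwa [h.range_eq] at this

lemma mem_of_ne (h : IsClusterGraph o F G β) {x : V} (hx : β x ≠ {o}ᶜ) : β x ∈ F :=
  (mem_clusters.1 (h.mem x)).resolve_left hx

/-- The vertex of a cluster. -/
lemma exists_vert (h : IsClusterGraph o F G β) {A : Finset (Fin n)} (hA : A ∈ clusters o F) :
    ∃ x, β x = A := by
  have : A ∈ Set.range β := by rw [h.range_eq]; exact hA
  exact this

lemma card_vert (h : IsClusterGraph o F G β) : Nat.card V = F.card + 1 := by
  rw [← Set.ncard_univ, ← Set.ncard_image_of_injective _ h.injective, Set.image_univ, h.range_eq,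
    Set.ncard_coe_finset, h.hierarchy.card_clusters]

end IsClusterGraph

lemma IsHierarchy.parent_spec_of_mem (h : IsHierarchy o F) {I : Finset (Fin n)} (hI : I ∈ F) :
    parent o F I ∈ clusters o F ∧ I ⊂ parent o F I ∧
      ∀ C ∈ clusters o F, I ⊂ C → parent o F I ⊆ C :=
  h.parent_spec (h.nonempty hI) (h.ssubset_compl hI)

/-- The edge from the vertex of `I` to the vertex of its parent. -/
noncomputable def clusterEdge [Nonempty V] (o : Fin n) (F : Finset (Finset (Fin n)))
    (β : V → Finset (Fin n)) (I : Finset (Fin n)) : Sym2 V :=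
  s(Function.invFun β I, Function.invFun β (parent o F I))

namespace IsClusterGraph

variable {G : SimpleGraph V} {β : V → Finset (Fin n)} [Nonempty V]

lemma apply_invFun (h : IsClusterGraph o F G β) {A : Finset (Fin n)} (hA : A ∈ clusters o F) :
    β (Function.invFun β A) = A :=
  Function.invFun_eq (h.exists_vert hA)

lemma clusterEdge_mem (h : IsClusterGraph o F G β) {I : Finset (Fin n)} (hI : I ∈ F) :
    clusterEdge o F β I ∈ G.edgeSet := by
  refine (h.adj_iff _ _).2 (Or.inl ?_)
  rw [h.apply_invFun (Finset.mem_insert_of_mem hI),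
    h.apply_invFun (h.hierarchy.parent_spec_of_mem hI).1]
  exact ⟨h.hierarchy.ne_compl hI, rfl⟩

/-- The edge above `I` is the only one between a cluster contained in `I` and one that is not. -/
lemma clusterEdge_eq_iff (h : IsClusterGraph o F G β) {I : Finset (Fin n)} (hI : I ∈ F) {x y : V}
    (hxy : G.Adj x y) : clusterEdge o F β I = s(x, y) ↔ ¬ (β x ⊆ I ↔ β y ⊆ I) := by
  have hI' : I ∈ clusters o F := Finset.mem_insert_of_mem hI
  have key : ∀ x y, β x ≠ {o}ᶜ → β y = parent o F (β x) →
      (clusterEdge o F β I = s(x, y) ↔ ¬ (β x ⊆ I ↔ β y ⊆ I)) := by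
    intro x y hx hy
    obtain ⟨h1, h2, h3⟩ := h.hierarchy.parent_spec_of_mem (h.mem_of_ne hx)
    rw [← hy] at h1 h2 h3
    by_cases hxI : β x = I
    · subst hxI
      rw [clusterEdge, ← hy, Function.leftInverse_invFun h.injective,
        Function.leftInverse_invFun h.injective]
      simp [h2.not_subset]
    · have hiff : β x ⊆ I ↔ β y ⊆ I :=
        ⟨fun hs => h3 I hI' (hs.ssubset_of_ne hxI), fun hs => h2.1.trans hs⟩
      simp only [hiff, not_true_eq_false, iff_false]
      intro he
      rcases Sym2.eq_iff.1 he with ⟨he1, -⟩ | ⟨he1, he2⟩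
      · exact hxI (by rw [← he1, h.apply_invFun hI'])
      · have h4 := h.hierarchy.parent_spec_of_mem hI
        have h5 : β y = I := by rw [← he1, h.apply_invFun hI']
        have h6 : β x = parent o F I := by rw [← he2, h.apply_invFun h4.1]
        rw [← h5, h5, ← h6] at h4
        rw [h5] at h2
        exact (h2.trans h4.2.1).ne rfl
  rcases (h.adj_iff x y).1 hxy with ⟨hx, hy⟩ | ⟨hy, hx⟩
  · exact key x y hx hy
  · rw [Sym2.eq_swap, key y x hy hx, iff_comm (a := β y ⊆ I)]

lemma exists_clusterEdge (h : IsClusterGraph o F G β) {e : Sym2 V} (he : e ∈ G.edgeSet) :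
    ∃ I ∈ F, clusterEdge o F β I = e := by
  induction e with
  | _ x y =>
    rcases (h.adj_iff x y).1 he with ⟨hx, hy⟩ | ⟨hy, hx⟩
    · refine ⟨β x, h.mem_of_ne hx, ?_⟩
      rw [clusterEdge, ← hy, Function.leftInverse_invFun h.injective,
        Function.leftInverse_invFun h.injective]
    · refine ⟨β y, h.mem_of_ne hy, ?_⟩
      rw [clusterEdge, ← hx, Function.leftInverse_invFun h.injective,
        Function.leftInverse_invFun h.injective, Sym2.eq_swap]

lemma clusterEdge_injOn (h : IsClusterGraph o F G β) :
    Set.InjOn (clusterEdge o F β) F := by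
  intro I hI J hJ he
  have hI' := h.apply_invFun (Finset.mem_insert_of_mem hI : I ∈ clusters o F)
  have hJ' := h.apply_invFun (Finset.mem_insert_of_mem hJ : J ∈ clusters o F)
  have hIs := h.hierarchy.parent_spec_of_mem hI
  have hJs := h.hierarchy.parent_spec_of_mem hJ
  rcases Sym2.eq_iff.1 he with ⟨he1, -⟩ | ⟨he1, he2⟩
  · rw [← hI', ← hJ', he1]
  · have h1 : I = parent o F J := by rw [← hI', he1, h.apply_invFun hJs.1]
    have h2 : parent o F I = J := by rw [← hJ', ← he2, h.apply_invFun hIs.1]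
    have h3 := hIs.2.1
    have h4 := hJs.2.1
    rw [h2] at h3
    rw [← h1] at h4
    exact absurd rfl (h3.trans h4).ne

lemma edgeSet_eq (h : IsClusterGraph o F G β) : G.edgeSet = clusterEdge o F β '' F := by
  ext e
  constructor
  · exact fun he => h.exists_clusterEdge he
  · rintro ⟨I, hI, rfl⟩
    exact h.clusterEdge_mem hI

lemma ncard_edgeSet (h : IsClusterGraph o F G β) : G.edgeSet.ncard = F.card := by
  rw [h.edgeSet_eq, h.clusterEdge_injOn.ncard_image, Set.ncard_coe_finset]

/-- Every passage of a walk through the edge above `I` crosses the boundary between the clusters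
contained in `I` and the others. -/
lemma count_clusterEdge [DecidableEq V] (h : IsClusterGraph o F G β) {I : Finset (Fin n)}
    (hI : I ∈ F) {a b : V} (p : G.Walk a b) :
    p.edges.count (clusterEdge o F β I) % 2 = if (β a ⊆ I ↔ β b ⊆ I) then 0 else 1 := by
  induction p with
  | nil => simp
  | @cons a c b hac p ih =>
    rw [SimpleGraph.Walk.edges_cons, List.count_cons, Nat.add_mod, ih]
    have := h.clusterEdge_eq_iff hI hac
    by_cases h1 : β a ⊆ I <;> by_cases h2 : β b ⊆ I <;> by_cases h3 : β c ⊆ I <;>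
      simp only [h1, h3, iff_true, iff_false, not_true_eq_false, not_false_eq_true] at this <;>
      simp [h1, h2, h3, eq_comm (a := s(a, c)), this]

lemma sum_edges_of_isPath (h : IsClusterGraph o F G β) (ℓ : Sym2 V → ℝ) {a b : V}
    (p : G.Walk a b) (hp : p.IsPath) :
    (p.edges.map ℓ).sum =
      ∑ I ∈ F, if (β a ⊆ I ↔ β b ⊆ I) then 0 else ℓ (clusterEdge o F β I) := by
  classical
  rw [Finset.sum_list_map_count]
  have hsub : p.edges.toFinset ⊆ F.image (clusterEdge o F β) := by
    intro e he
    obtain ⟨I, hI, rfl⟩ := h.exists_clusterEdge (p.edges_subset_edgeSet (List.mem_toFinset.1 he))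
    exact Finset.mem_image_of_mem _ hI
  rw [Finset.sum_subset hsub, Finset.sum_image h.clusterEdge_injOn]
  · refine Finset.sum_congr rfl fun I hI => ?_
    have h1 := h.count_clusterEdge hI p
    have h2 := List.nodup_iff_count_le_one.1 hp.isTrail.edges_nodup (clusterEdge o F β I)
    split_ifs at h1 ⊢
    · rw [show p.edges.count (clusterEdge o F β I) = 0 by omega, zero_smul]
    · rw [show p.edges.count (clusterEdge o F β I) = 1 by omega, one_smul]
  · intro e _ he
    rw [List.count_eq_zero_of_not_mem (by simpa using he), zero_smul]

lemma connected (h : IsClusterGraph o F G β) : G.Connected := by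
  obtain ⟨r, hr⟩ := h.exists_vert (Finset.mem_insert_self _ _ : {o}ᶜ ∈ clusters o F)
  have key : ∀ k : ℕ, ∀ x, n ≤ (β x).card + k → G.Reachable x r := by
    intro k
    induction k with
    | zero =>
      intro x hx
      have := Finset.card_le_card (h.hierarchy.cluster_subset (h.mem x))
      rw [card_compl_singleton] at this
      have := o.2
      omega
    | succ k ih =>
      intro x hx
      by_cases hxr : β x = {o}ᶜ
      · rw [h.injective (hxr.trans hr.symm)]
      · obtain ⟨h1, h2, -⟩ := h.hierarchy.parent_spec_of_mem (h.mem_of_ne hxr)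
        obtain ⟨y, hy⟩ := h.exists_vert h1
        have hadj : G.Adj x y := (h.adj_iff x y).2 (Or.inl ⟨hxr, hy⟩)
        refine hadj.reachable.trans (ih y ?_)
        have := Finset.card_lt_card h2
        rw [hy]
        omega
  exact ⟨fun x y => (key n x (by omega)).trans (key n y (by omega)).symm⟩

lemma isTree [Finite V] (h : IsClusterGraph o F G β) : G.IsTree := by
  rw [SimpleGraph.isTree_iff_connected_and_card]
  refine ⟨h.connected, ?_⟩
  rw [h.card_vert, ← h.ncard_edgeSet]
  rfl

end IsClusterGraph

/-- The marked tree `T` is the tree of the hierarchy `F`, with `β v` the set of labels below the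
vertex `v` when the end `o` is placed at the top. -/
structure MarkedTree.Represents (T : MarkedTree n) (o : Fin n) (F : Finset (Finset (Fin n)))
    (β : T.Vert → Finset (Fin n)) : Prop extends IsClusterGraph o F T.graph β where
  root_base : β (T.root o) = {o}ᶜ
  root_ne : ∀ i, i ≠ o → β (T.root i) = parent o F {i}

namespace MarkedTree.Represents

variable {T : MarkedTree n} {β : T.Vert → Finset (Fin n)}

lemma root_subset_iff (h : T.Represents o F β) (hn : 3 ≤ n) {I : Finset (Fin n)} (hI : I ∈ F)
    (i : Fin n) : β (T.root i) ⊆ I ↔ i ∈ I := by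
  by_cases hi : i = o
  · subst hi
    rw [h.root_base]
    exact iff_of_false (h.hierarchy.ssubset_compl hI).not_subset (h.hierarchy.base_notMem I hI)
  · obtain ⟨h1, h2, h3⟩ := h.hierarchy.branch_parent_spec hn
      (mem_branches.2 (Or.inr ⟨i, hi, rfl⟩) : {i} ∈ branches o F)
    rw [h.root_ne i hi]
    refine ⟨fun hs => hs (h2.1 (Finset.mem_singleton_self i)), fun hiI => ?_⟩
    refine h3 I (Finset.mem_insert_of_mem hI) ?_
    refine (Finset.singleton_subset_iff.2 hiI).ssubset_of_ne fun e => ?_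
    have := h.hierarchy.one_lt_card I hI
    rw [← e, Finset.card_singleton] at this
    omega

lemma distVec_eq [Nonempty T.Vert] (h : T.Represents o F β) (hn : 3 ≤ n) (ℓ : Sym2 T.Vert → ℝ) :
    T.distVec ℓ = ∑ I ∈ F, ℓ (clusterEdge o F β I) • splitDist I := by
  funext ⟨e, he⟩
  rw [Finset.sum_apply]
  induction e with
  | _ i j =>
    change T.pathLength ℓ (T.root i) (T.root j) = _
    rw [MarkedTree.pathLength, h.sum_edges_of_isPath ℓ _ (T.path_isPath _ _)]
    refine Finset.sum_congr rfl fun I hI => ?_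
    rw [if_congr (iff_congr (h.root_subset_iff hn hI i) (h.root_subset_iff hn hI j)) rfl rfl]
    change _ = ℓ _ * if (i ∈ I ↔ j ∈ I) then (0 : ℝ) else 1
    split_ifs <;> simp

lemma qMap_distVec [Nonempty T.Vert] (h : T.Represents o F β) (hn : 3 ≤ n)
    (ℓ : Sym2 T.Vert → ℝ) :
    qMap n (T.distVec ℓ) = ∑ I ∈ F, ℓ (clusterEdge o F β I) • splitVec I := by
  rw [h.distVec_eq hn, map_sum]
  exact Finset.sum_congr rfl fun I _ => map_smul _ _ _

lemma cell_eq (h : T.Represents o F β) (hn : 3 ≤ n) : T.cell = hierarchyCone F := by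
  have : Nonempty T.Vert := ⟨T.root o⟩
  ext x
  constructor
  · rintro ⟨ℓ, hℓ, rfl⟩
    exact ⟨fun I => ℓ (clusterEdge o F β I), fun I hI => hℓ _ (h.clusterEdge_mem hI),
      h.qMap_distVec hn ℓ⟩
  · rintro ⟨c, hc, rfl⟩
    refine ⟨fun e => c (Function.invFunOn (clusterEdge o F β) F e), ?_, ?_⟩
    · intro e he
      exact hc _ (Function.invFunOn_mem (h.exists_clusterEdge he))
    · rw [h.qMap_distVec hn]
      exact Finset.sum_congr rfl fun I hI => by
        rw [h.clusterEdge_injOn.leftInvOn_invFunOn hI]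

/-- A hierarchy determines its tree. -/
lemma exists_iso {T' : MarkedTree n} {β' : T'.Vert → Finset (Fin n)} (h : T.Represents o F β)
    (h' : T'.Represents o F β') :
    ∃ f : T.graph ≃g T'.graph, (∀ x, β' (f x) = β x) ∧ ∀ i, f (T.root i) = T'.root i := by
  choose g hg using fun x => h'.exists_vert (h.mem x)
  have hbij : Function.Bijective g := by
    constructor
    · intro x y hxy
      apply h.injective
      rw [← hg, ← hg, hxy]
    · intro y
      obtain ⟨x, hx⟩ := h.exists_vert (h'.mem y)
      exact ⟨x, h'.injective (by rw [hg, hx])⟩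
  refine ⟨⟨Equiv.ofBijective g hbij, ?_⟩, hg, fun i => h'.injective ?_⟩
  · intro x y
    change T'.graph.Adj (g x) (g y) ↔ _
    rw [h'.adj_iff, h.adj_iff, hg, hg]
  · change β' (g _) = _
    rw [hg]
    by_cases hi : i = o
    · subst hi; rw [h.root_base, h'.root_base]
    · rw [h.root_ne i hi, h'.root_ne i hi]

end MarkedTree.Represents

/-- Every hierarchy has a tree: the vertices are the clusters, and each end is attached to the
smallest cluster that contains its label. -/
lemma IsHierarchy.exists_represents (h : IsHierarchy o F) (hn : 3 ≤ n) :
    ∃ (T : MarkedTree n) (β : T.Vert → Finset (Fin n)), T.Represents o F β := by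
  let V := {A // A ∈ clusters o F}
  let G : SimpleGraph V :=
    { Adj x y := (x.1 ≠ {o}ᶜ ∧ y.1 = parent o F x.1) ∨ (y.1 ≠ {o}ᶜ ∧ x.1 = parent o F y.1)
      symm := ⟨fun x y hxy => hxy.symm⟩
      loopless := ⟨fun x hx => by
        have hx : x.1 ≠ {o}ᶜ ∧ x.1 = parent o F x.1 := hx.elim id id
        have := h.parent_spec_of_mem ((mem_clusters.1 x.2).resolve_left hx.1)
        exact this.2.1.ne hx.2⟩ }
  have hG : IsClusterGraph o F G (Subtype.val : V → Finset (Fin n)) :=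
    ⟨h, Subtype.val_injective, Subtype.range_coe, fun _ _ => Iff.rfl⟩
  have : Nonempty V := ⟨⟨_, Finset.mem_insert_self _ _⟩⟩
  have hbr : ∀ i, i ≠ o → {i} ∈ branches o F := fun i hi => mem_branches.2 (Or.inr ⟨i, hi, rfl⟩)
  let root : Fin n → V := fun i =>
    if hi : i = o then ⟨{o}ᶜ, Finset.mem_insert_self _ _⟩
    else ⟨parent o F {i}, (h.branch_parent_spec hn (hbr i hi)).1⟩
  have hro : (root o).1 = {o}ᶜ := by simp [root]
  have hri : ∀ i, i ≠ o → (root i).1 = parent o F {i} := fun i hi => by simp [root, hi]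
  have hval : ∀ v, 3 ≤ (G.neighborSet v).ncard + {i | root i = v}.ncard := by
    rintro ⟨A, hA⟩
    have h2 := h.two_le_card_parts hn hA
    let P := F.filter (parent o F · = A)
    let S := Finset.univ.filter fun i => i ≠ o ∧ parent o F {i} = A
    have hPS : (parts o F A).card ≤ P.card + S.card := by
      have : parts o F A ⊆ P ∪ S.image singleton := by
        intro B hB
        obtain ⟨hB, hBA⟩ := mem_parts.1 hB
        rcases mem_branches.1 hB with hB | ⟨i, hi, rfl⟩
        · exact Finset.mem_union_left _ (Finset.mem_filter.2 ⟨hB, hBA⟩)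
        · exact Finset.mem_union_right _ (Finset.mem_image_of_mem _ (by simp [S, hi, hBA]))
      refine (Finset.card_le_card this).trans ((Finset.card_union_le _ _).trans ?_)
      exact Nat.add_le_add_left Finset.card_image_le _
    rw [← Set.ncard_image_of_injective _ Subtype.val_injective]
    have hchild : ∀ B ∈ P, B ∈ Subtype.val '' G.neighborSet (⟨A, hA⟩ : V) := by
      intro B hB
      obtain ⟨hB, hBA⟩ := Finset.mem_filter.1 hB
      exact ⟨⟨B, Finset.mem_insert_of_mem hB⟩, Or.inr ⟨h.ne_compl hB, hBA.symm⟩, rfl⟩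
    have hend : ∀ i ∈ S, root i = (⟨A, hA⟩ : V) := by
      intro i hi
      obtain ⟨-, hio, hi⟩ := Finset.mem_filter.1 hi
      exact Subtype.ext ((hri i hio).trans hi)
    by_cases hAo : A = {o}ᶜ
    · have h3 : P.card ≤ (Subtype.val '' G.neighborSet (⟨A, hA⟩ : V)).ncard := by
        rw [← Set.ncard_coe_finset]
        exact Set.ncard_le_ncard hchild (Set.toFinite _)
      have h4 : (insert o S).card ≤ {i | root i = (⟨A, hA⟩ : V)}.ncard := by
        rw [← Set.ncard_coe_finset]
        refine Set.ncard_le_ncard (fun i hi => ?_) (Set.toFinite _)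
        rcases Finset.mem_insert.1 hi with rfl | hi
        · exact Subtype.ext (hro.trans hAo.symm)
        · exact hend i hi
      rw [Finset.card_insert_of_notMem (by simp [S])] at h4
      omega
    · have hspec := h.parent_spec_of_mem ((mem_clusters.1 hA).resolve_left hAo)
      have h3 : (insert (parent o F A) P).card ≤
          (Subtype.val '' G.neighborSet (⟨A, hA⟩ : V)).ncard := by
        rw [← Set.ncard_coe_finset]
        refine Set.ncard_le_ncard (fun B hB => ?_) (Set.toFinite _)
        rcases Finset.mem_insert.1 hB with rfl | hB
        · exact ⟨⟨_, hspec.1⟩, Or.inl ⟨hAo, rfl⟩, rfl⟩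
        · exact hchild B hB
      have h4 : S.card ≤ {i | root i = (⟨A, hA⟩ : V)}.ncard := by
        rw [← Set.ncard_coe_finset]
        exact Set.ncard_le_ncard hend (Set.toFinite _)
      rw [Finset.card_insert_of_notMem] at h3
      · omega
      · intro hP
        obtain ⟨hP, hPA⟩ := Finset.mem_filter.1 hP
        have := (h.parent_spec_of_mem hP).2.1
        rw [hPA] at this
        exact (this.trans hspec.2.1).ne rfl
  exact ⟨⟨V, G, hG.isTree, root, hval⟩, Subtype.val, ⟨hG, hro, hri⟩⟩

end ClusterTrees

/-! ### The hierarchy of a marked tree -/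

namespace MarkedTree

variable {n : ℕ} (T : MarkedTree n) (r : T.Vert)

/-- In the tree rooted at `r`, the vertex `v` is an ancestor of `x`, or `x` itself. -/
def IsAncestor (v x : T.Vert) : Prop := v ∈ (T.path x r).support

/-- The next vertex on the path from `x` to the root `r`; it is `r` itself for `x = r`. -/
noncomputable def up (x : T.Vert) : T.Vert := (T.path x r).snd

lemma isAncestor_refl (x : T.Vert) : T.IsAncestor r x x := SimpleGraph.Walk.start_mem_support _

lemma isAncestor_root (x : T.Vert) : T.IsAncestor r r x := SimpleGraph.Walk.end_mem_support _

lemma path_self : T.path r r = .nil := (T.eq_path .nil .nil).symm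

lemma isAncestor_root_iff {v : T.Vert} : T.IsAncestor r v r ↔ v = r := by
  rw [IsAncestor, path_self, SimpleGraph.Walk.mem_support_nil_iff]

variable {T r}

lemma IsAncestor.trans {v w x : T.Vert} (h : T.IsAncestor r w v) (h' : T.IsAncestor r v x) :
    T.IsAncestor r w x := by
  classical
  unfold IsAncestor at h
  rw [← T.eq_path _ ((T.path_isPath x r).dropUntil h')] at h
  exact SimpleGraph.Walk.support_dropUntil_subset_support _ h' h

lemma not_nil_path {x : T.Vert} (hx : x ≠ r) : ¬ (T.path x r).Nil :=
  SimpleGraph.Walk.not_nil_of_ne hx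

lemma adj_up {x : T.Vert} (hx : x ≠ r) : T.graph.Adj x (T.up r x) :=
  SimpleGraph.Walk.adj_snd (not_nil_path hx)

lemma path_eq_cons {x : T.Vert} (hx : x ≠ r) :
    T.path x r = .cons (adj_up hx) (T.path (T.up r x) r) := by
  rw [show T.path (T.up r x) r = _ from (T.eq_path _ (T.path_isPath x r).tail).symm]
  exact (SimpleGraph.Walk.cons_tail_eq _ (not_nil_path hx)).symm

lemma isAncestor_iff {v x : T.Vert} (hx : x ≠ r) :
    T.IsAncestor r v x ↔ v = x ∨ T.IsAncestor r v (T.up r x) := by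
  unfold IsAncestor
  conv_lhs => rw [path_eq_cons hx]
  rw [SimpleGraph.Walk.support_cons, List.mem_cons]

lemma isAncestor_up (x : T.Vert) : T.IsAncestor r (T.up r x) x :=
  SimpleGraph.Walk.getVert_mem_support _ _

lemma length_path {x : T.Vert} (hx : x ≠ r) :
    (T.path x r).length = (T.path (T.up r x) r).length + 1 := by
  conv_lhs => rw [path_eq_cons hx]
  rw [SimpleGraph.Walk.length_cons]

lemma IsAncestor.length_lt {v x : T.Vert} (h : T.IsAncestor r v x) (hne : v ≠ x) :
    (T.path v r).length < (T.path x r).length := by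
  generalize hk : (T.path x r).length = k
  induction k generalizing x with
  | zero =>
    have hx : x = r := SimpleGraph.Walk.eq_of_length_eq_zero hk
    subst hx
    exact absurd ((T.isAncestor_root_iff x).1 h) hne
  | succ k ih =>
    have hx : x ≠ r := by
      rintro rfl
      rw [path_self, SimpleGraph.Walk.length_nil] at hk
      omega
    rw [length_path hx] at hk
    have h := ((isAncestor_iff hx).1 h).resolve_left hne
    by_cases hv : v = T.up r x
    · subst hv; omega
    · have := ih h hv (by omega)
      omega

lemma IsAncestor.antisymm {v x : T.Vert} (h : T.IsAncestor r v x) (h' : T.IsAncestor r x v) :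
    v = x := by
  by_contra hne
  have h1 := h.length_lt hne
  have h2 := h'.length_lt (Ne.symm hne)
  omega

/-- The ancestors of a vertex form a chain. -/
lemma IsAncestor.total {v w x : T.Vert} (h : T.IsAncestor r v x) (h' : T.IsAncestor r w x) :
    T.IsAncestor r v w ∨ T.IsAncestor r w v := by
  generalize hk : (T.path x r).length = k
  induction k generalizing x with
  | zero =>
    have hx : x = r := SimpleGraph.Walk.eq_of_length_eq_zero hk
    subst hx
    rw [isAncestor_root_iff] at h
    subst h
    exact Or.inr h'
  | succ k ih =>
    have hx : x ≠ r := by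
      rintro rfl
      rw [path_self, SimpleGraph.Walk.length_nil] at hk
      omega
    rw [length_path hx] at hk
    rcases (isAncestor_iff hx).1 h with rfl | h1
    · exact Or.inr h'
    · rcases (isAncestor_iff hx).1 h' with rfl | h2
      · exact Or.inl h
      · exact ih h1 h2 (by omega)

lemma up_ne {x : T.Vert} (hx : x ≠ r) : T.up r x ≠ x := (adj_up hx).ne'

/-- The edges of a rooted tree join each vertex to its parent. -/
lemma adj_iff_up {x y : T.Vert} :
    T.graph.Adj x y ↔ (x ≠ r ∧ y = T.up r x) ∨ (y ≠ r ∧ x = T.up r y) := by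
  constructor
  · intro hxy
    have key : ∀ x y, T.graph.Adj x y → T.IsAncestor r y x → x ≠ r ∧ y = T.up r x := by
      intro x y hxy h
      refine ⟨?_, T.isTree.isAcyclic.eq_snd_of_adj_start (T.path_isPath x r) hxy h⟩
      rintro rfl
      exact hxy.ne ((T.isAncestor_root_iff _).1 h).symm
    by_cases h : T.IsAncestor r y x
    · exact Or.inl (key x y hxy h)
    · refine Or.inr (key y x hxy.symm ?_)
      unfold IsAncestor
      rw [← T.eq_path _ ((T.path_isPath x r).cons (h := hxy.symm) h)]
      simp
  · rintro (⟨hx, rfl⟩ | ⟨hy, rfl⟩)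
    · exact adj_up hx
    · exact (adj_up hy).symm

lemma IsAncestor.up_of_ne {v x : T.Vert} (h : T.IsAncestor r v x) (hne : v ≠ x) :
    T.IsAncestor r v (T.up r x) := by
  by_cases hx : x = r
  · subst hx
    exact absurd ((T.isAncestor_root_iff x).1 h) hne
  · exact ((isAncestor_iff hx).1 h).resolve_left hne

variable (T)

open Classical in
/-- The labels of the ends, other than the end `o`, that are attached to descendants of `v` when the
tree is rooted at the end `o`. -/
noncomputable def below (o : Fin n) (v : T.Vert) : Finset (Fin n) :=
  Finset.univ.filter fun i => i ≠ o ∧ T.IsAncestor (T.root o) v (T.root i)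

variable {T} {o : Fin n}

lemma mem_below {v : T.Vert} {i : Fin n} :
    i ∈ T.below o v ↔ i ≠ o ∧ T.IsAncestor (T.root o) v (T.root i) := by
  simp [below]

lemma below_mono {v w : T.Vert} (h : T.IsAncestor (T.root o) v w) :
    T.below o w ⊆ T.below o v := by
  intro i hi
  rw [mem_below] at hi ⊢
  exact ⟨hi.1, h.trans hi.2⟩

lemma below_root : T.below o (T.root o) = {o}ᶜ := by
  ext i
  simp [mem_below, isAncestor_root]

/-- A descendant of `v` of maximal depth is a leaf of the tree of bounded edges, so at least two
ends other than `o` are attached to it. -/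
lemma one_lt_card_below (v : T.Vert) : 1 < (T.below o v).card := by
  have := T.finite
  set r := T.root o with hr
  obtain ⟨x, hx, hmax⟩ := Set.exists_max_image {x | T.IsAncestor r v x}
    (fun x => (T.path x r).length) (Set.toFinite _) ⟨v, T.isAncestor_refl r v⟩
  have hnochild : ∀ y, y ≠ r → x ≠ T.up r y := by
    rintro y hy rfl
    have h1 := hmax y (hx.trans (isAncestor_up y))
    have h2 := length_path hy
    omega
  have hval := T.three_le_valence x
  have hsub : {i | T.root i = x} \ {o} ⊆ (T.below o v : Set (Fin n)) := by
    rintro i ⟨hi, hio⟩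
    rw [Finset.mem_coe, mem_below]
    have hi : T.root i = x := hi
    exact ⟨hio, hi ▸ hx⟩
  have hle := Set.ncard_le_ncard hsub (Set.toFinite _)
  rw [Set.ncard_coe_finset] at hle
  by_cases hxr : x = r
  · have h0 : T.graph.neighborSet x = ∅ := by
      rw [Set.eq_empty_iff_forall_notMem]
      intro y hy
      rcases adj_iff_up.1 hy with h | h
      · exact h.1 hxr
      · exact hnochild y h.1 h.2
    rw [h0, Set.ncard_empty] at hval
    have := Set.ncard_le_ncard_sdiff_add_ncard {i | T.root i = x} {o}
    rw [Set.ncard_singleton] at this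
    omega
  · have h1 : T.graph.neighborSet x ⊆ {T.up r x} := by
      intro y hy
      rcases adj_iff_up.1 hy with h | h
      · exact h.2
      · exact absurd h.2 (hnochild y h.1)
    have h2 := Set.ncard_le_ncard h1
    rw [Set.ncard_singleton] at h2
    rw [Set.sdiff_singleton_eq_self (show o ∉ {i | T.root i = x} from fun e => hxr e.symm)] at hle
    omega

/-- If `below` did not change along the edge from `c` to its parent `v`, then that edge and the
edge (or, at the root, the end) towards `o` would be the only ones at `v`. -/
lemma below_ssubset_up {c : T.Vert} (hc : c ≠ T.root o) :
    T.below o c ⊂ T.below o (T.up (T.root o) c) := by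
  have := T.finite
  set r := T.root o with hr
  set v := T.up r c with hv
  refine (below_mono (isAncestor_up c)).ssubset_of_ne fun he => ?_
  have hlabels : {i | T.root i = v} ⊆ {i | i = o ∧ v = r} := by
    intro i hi
    have hi : T.root i = v := hi
    by_cases hio : i = o
    · subst hio; exact ⟨rfl, hi.symm⟩
    · have : i ∈ T.below o c := by
        rw [he, mem_below, hi]; exact ⟨hio, T.isAncestor_refl _ _⟩
      have h1 := (mem_below.1 this).2
      rw [hi] at h1
      exact absurd (h1.antisymm (isAncestor_up c)).symm (up_ne hc)
  have hnbr : T.graph.neighborSet v ⊆ insert c {y | v ≠ r ∧ y = T.up r v} := by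
    intro y hy
    rcases adj_iff_up.1 hy with h | ⟨hyr, hvy⟩
    · exact Or.inr h
    · left
      by_contra hyc
      obtain ⟨i, hi⟩ : (T.below o y).Nonempty :=
        Finset.card_pos.1 (by have := one_lt_card_below (o := o) y; omega)
      have hi1 : i ∈ T.below o c := by
        rw [he]
        exact below_mono (hvy ▸ isAncestor_up y : T.IsAncestor r v y) hi
      rcases (mem_below.1 hi1).2.total (mem_below.1 hi).2 with h | h
      · have := h.up_of_ne (Ne.symm hyc)
        rw [← hvy] at this
        exact up_ne hc (this.antisymm (isAncestor_up c)).symm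
      · have := h.up_of_ne hyc
        have h2 : T.IsAncestor r v y := by rw [hvy]; exact isAncestor_up y
        exact up_ne hyr (hvy ▸ (h2.antisymm this))
  have hval := T.three_le_valence v
  have h1 := Set.ncard_le_ncard hlabels (Set.toFinite _)
  have h2 := Set.ncard_le_ncard hnbr (Set.toFinite _)
  have h3 := Set.ncard_insert_le c {y | v ≠ r ∧ y = T.up r v}
  by_cases hvr : v = r
  · have h4 : {i | i = o ∧ v = r} = {o} := by ext; simp [hvr]
    have h5 : {y | v ≠ r ∧ y = T.up r v} = ∅ := by ext; simp [hvr]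
    rw [h4, Set.ncard_singleton] at h1
    rw [h5, Set.ncard_empty] at h3
    rw [h5] at h2
    omega
  · have h4 : {i : Fin n | i = o ∧ v = r} = ∅ := by ext; simp [hvr]
    have h5 : {y | v ≠ r ∧ y = T.up r v} = {T.up r v} := by ext; simp [hvr]
    rw [h4, Set.ncard_empty] at h1
    rw [h5, Set.ncard_singleton] at h3
    rw [h5] at h2
    omega

lemma below_ssubset {v w : T.Vert} (h : T.IsAncestor (T.root o) v w) (hne : v ≠ w) :
    T.below o w ⊂ T.below o v := by
  have hw : w ≠ T.root o := by
    rintro rfl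
    exact hne ((T.isAncestor_root_iff _).1 h)
  exact (below_ssubset_up hw).trans_subset (below_mono (h.up_of_ne hne))

lemma below_nonempty (v : T.Vert) : (T.below o v).Nonempty :=
  Finset.card_pos.1 (by have := one_lt_card_below (o := o) v; omega)

lemma below_subset_iff {v w : T.Vert} :
    T.below o w ⊆ T.below o v ↔ T.IsAncestor (T.root o) v w := by
  refine ⟨fun hs => ?_, below_mono⟩
  obtain ⟨i, hi⟩ := below_nonempty (o := o) w
  rcases (mem_below.1 (hs hi)).2.total (mem_below.1 hi).2 with h | h
  · exact h
  · by_cases hne : w = v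
    · subst hne; exact h
    · exact absurd hs (below_ssubset h hne).not_subset

lemma below_injective : Function.Injective (T.below o) := fun _ _ h =>
  (below_subset_iff.1 h.superset).antisymm (below_subset_iff.1 h.subset)

/-- Every marked tree is the tree of a hierarchy. -/
lemma exists_represents (T : MarkedTree n) (o : Fin n) :
    ∃ F, T.Represents o F (T.below o) := by
  classical
  have := T.finite
  set r := T.root o with hr
  let F : Finset (Finset (Fin n)) :=
    (Set.toFinite (T.below o '' {v | v ≠ r})).toFinset
  have hF : ∀ {I}, I ∈ F ↔ ∃ v, v ≠ r ∧ T.below o v = I := by simp [F]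
  have hcl : ∀ {A}, A ∈ clusters o F ↔ ∃ v, T.below o v = A := by
    intro A
    rw [mem_clusters, hF]
    constructor
    · rintro (rfl | ⟨v, -, rfl⟩)
      · exact ⟨r, below_root⟩
      · exact ⟨v, rfl⟩
    · rintro ⟨v, rfl⟩
      by_cases hv : v = r
      · left; rw [hv, below_root]
      · exact Or.inr ⟨v, hv, rfl⟩
  have hne : ∀ v, T.below o v ≠ {o}ᶜ ↔ v ≠ r := by
    intro v
    rw [← below_root (T := T), below_injective.ne_iff]
  have hier : IsHierarchy o F := by
    refine ⟨fun I hI => ?_, fun I hI => ?_, fun I hI => ?_, fun I hI J hJ => ?_⟩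
    · obtain ⟨v, -, rfl⟩ := hF.1 hI
      exact fun h => (mem_below.1 h).1 rfl
    · obtain ⟨v, -, rfl⟩ := hF.1 hI
      exact one_lt_card_below v
    · obtain ⟨v, hv, rfl⟩ := hF.1 hI
      have := Finset.card_lt_card (below_ssubset (T.isAncestor_root r v) (Ne.symm hv))
      rw [below_root, card_compl_singleton] at this
      omega
    · obtain ⟨v, -, rfl⟩ := hF.1 hI
      obtain ⟨w, -, rfl⟩ := hF.1 hJ
      by_cases hd : Disjoint (T.below o v) (T.below o w)
      · exact Or.inr (Or.inr hd)
      · obtain ⟨i, hi, hi'⟩ := Finset.not_disjoint_iff.1 hd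
        rcases (mem_below.1 hi).2.total (mem_below.1 hi').2 with h | h
        · exact Or.inr (Or.inl (below_mono h))
        · exact Or.inl (below_mono h)
  have hup : ∀ x, x ≠ r → parent o F (T.below o x) = T.below o (T.up r x) := by
    intro x hx
    refine hier.parent_eq (below_nonempty x) (hcl.2 ⟨_, rfl⟩) (below_ssubset_up hx) ?_
    intro C hC hxC
    obtain ⟨z, rfl⟩ := hcl.1 hC
    refine below_mono ((below_subset_iff.1 hxC.1).up_of_ne ?_)
    rintro rfl
    exact hxC.ne rfl
  refine ⟨F, ⟨hier, below_injective, ?_, fun x y => ?_⟩, below_root, fun i hi => ?_⟩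
  · ext A
    rw [Finset.mem_coe, hcl, Set.mem_range]
  · have key : ∀ x y, (T.below o x ≠ {o}ᶜ ∧ T.below o y = parent o F (T.below o x)) ↔
        (x ≠ r ∧ y = T.up r x) := by
      intro x y
      rw [hne]
      refine and_congr_right fun hx => ?_
      rw [hup x hx, below_injective.eq_iff]
    rw [key, key]
    exact adj_iff_up
  · refine (hier.parent_eq (Finset.singleton_nonempty i) (hcl.2 ⟨_, rfl⟩) ?_ ?_).symm
    · refine (Finset.singleton_subset_iff.2 (mem_below.2 ⟨hi, T.isAncestor_refl _ _⟩)).ssubset_of_ne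
        fun e => ?_
      have := one_lt_card_below (o := o) (T.root i)
      rw [← e, Finset.card_singleton] at this
      omega
    · intro C hC hiC
      obtain ⟨z, rfl⟩ := hcl.1 hC
      exact below_mono (mem_below.1 (hiC.1 (Finset.mem_singleton_self i))).2

end MarkedTree

/-! ### The fan of all hierarchies -/

section ModuliFan

variable {n : ℕ} {o : Fin n} {F : Finset (Finset (Fin n))}

lemma mem_moduliFan (hn : 3 ≤ n) (o : Fin n) {σ : Set (Q n)} :
    σ ∈ moduliFan n ↔ ∃ F, IsHierarchy o F ∧ σ = hierarchyCone F := by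
  constructor
  · rintro ⟨T, rfl⟩
    obtain ⟨F, hF⟩ := T.exists_represents o
    exact ⟨F, hF.hierarchy, hF.cell_eq hn⟩
  · rintro ⟨F, hF, rfl⟩
    obtain ⟨T, β, hT⟩ := hF.exists_represents hn
    exact ⟨T, (hT.cell_eq hn).symm⟩

namespace IsHierarchy

lemma coneDim_eq (h : IsHierarchy o F) : coneDim (hierarchyCone F) = F.card := by
  obtain ⟨f, hf⟩ := h.exists_isUnimodular
  exact hf.coneDim

lemma isFace_iff (h : IsHierarchy o F) (hn : 3 ≤ n) {τ : Set (Q n)} :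
    IsFace (splitLattice n) τ (hierarchyCone F) ↔ ∃ F' ⊆ F, τ = hierarchyCone F' := by
  obtain ⟨f, hf⟩ := h.exists_isUnimodular
  exact hf.isFace_iff (isLatticeIn_splitLattice hn)

lemma isFace_cone_iff (h : IsHierarchy o F) (hn : 3 ≤ n) {F' : Finset (Finset (Fin n))}
    (h' : IsHierarchy o F') :
    IsFace (splitLattice n) (hierarchyCone F') (hierarchyCone F) ↔ F' ⊆ F := by
  rw [h.isFace_iff hn]
  refine ⟨?_, fun hs => ⟨F', hs, rfl⟩⟩
  rintro ⟨G, hG, he⟩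
  rwa [h'.cone_inj (h.subset hG) he]

end IsHierarchy

lemma isFan_moduliFan (hn : 3 ≤ n) : IsFan (splitLattice n) (moduliFan n) := by
  have o : Fin n := ⟨0, by omega⟩
  refine ⟨?_, fun σ hσ => ?_, fun σ hσ τ hτ => ?_, fun σ hσ σ' hσ' => ?_⟩
  · refine (Set.finite_range (hierarchyCone (n := n))).subset fun σ hσ => ?_
    obtain ⟨F, -, rfl⟩ := (mem_moduliFan hn o).1 hσ
    exact ⟨F, rfl⟩
  · obtain ⟨F, hF, rfl⟩ := (mem_moduliFan hn o).1 hσ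
    obtain ⟨f, hf⟩ := hF.exists_isUnimodular
    exact hf.isCone (isLatticeIn_splitLattice hn)
  · obtain ⟨F, hF, rfl⟩ := (mem_moduliFan hn o).1 hσ
    obtain ⟨F', hF', rfl⟩ := (hF.isFace_iff hn).1 hτ
    exact (mem_moduliFan hn o).2 ⟨F', hF.subset hF', rfl⟩
  · obtain ⟨F, hF, rfl⟩ := (mem_moduliFan hn o).1 hσ
    obtain ⟨F', hF', rfl⟩ := (mem_moduliFan hn o).1 hσ'
    rw [hF.inter hF', hF.isFace_iff hn, hF'.isFace_iff hn]
    exact ⟨⟨_, Finset.inter_subset_left, rfl⟩, ⟨_, Finset.inter_subset_right, rfl⟩⟩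

/-- A hierarchy with fewer than `n - 3` members is not maximal. -/
lemma IsHierarchy.exists_insert (h : IsHierarchy o F) (hn : 3 ≤ n) (hF : F.card + 3 < n) :
    ∃ I ∉ F, IsHierarchy o (insert I F) := by
  obtain ⟨A, hA, hA3⟩ := h.exists_three_le_card_parts hn hF
  obtain ⟨B₁, h₁, B₂, h₂, hne⟩ := Finset.one_lt_card.1 (show 1 < (parts o F A).card by omega)
  exact ⟨_, h.insert_union hn hA hA3 h₁ h₂ hne⟩

lemma exists_hierarchy_card_eq (hn : 3 ≤ n) (o : Fin n) :
    ∃ F, IsHierarchy o F ∧ F.card = n - 3 := by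
  have key : ∀ k ≤ n - 3, ∃ F, IsHierarchy o F ∧ F.card = k := by
    intro k
    induction k with
    | zero => exact fun _ => ⟨∅, isHierarchy_empty o, rfl⟩
    | succ k ih =>
      intro hk
      obtain ⟨F, hF, rfl⟩ := ih (by omega)
      obtain ⟨I, hI, hIF⟩ := hF.exists_insert hn (by omega)
      exact ⟨_, hIF, Finset.card_insert_of_notMem hI⟩
  exact key _ le_rfl

lemma hasPureDim_moduliFan (hn : 3 ≤ n) : HasPureDim (moduliFan n) (n - 3) := by
  have o : Fin n := ⟨0, by omega⟩
  refine ⟨⟨?_, ?_⟩, fun σ hσ hmax => ?_⟩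
  · obtain ⟨F, hF, hcard⟩ := exists_hierarchy_card_eq hn o
    exact ⟨_, (mem_moduliFan hn o).2 ⟨F, hF, rfl⟩, by rw [hF.coneDim_eq, hcard]⟩
  · rintro _ ⟨σ, hσ, rfl⟩
    obtain ⟨F, hF, rfl⟩ := (mem_moduliFan hn o).1 hσ
    have := hF.card_add_three_le hn
    rw [hF.coneDim_eq]
    omega
  · obtain ⟨F, hF, rfl⟩ := (mem_moduliFan hn o).1 hσ
    have hle := hF.card_add_three_le hn
    rw [hF.coneDim_eq]
    by_contra hne
    obtain ⟨I, hI, hIF⟩ := hF.exists_insert hn (by omega)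
    have := hmax _ ((mem_moduliFan hn o).2 ⟨_, hIF, rfl⟩) (finCone_mono (Finset.subset_insert I F))
    exact hI (hF.cone_inj hIF this.symm ▸ Finset.mem_insert_self I F)

lemma sUnion_moduliFan (hn : 3 ≤ n) : ⋃₀ moduliFan n = Set.range (phiMap n) := by
  have o : Fin n := ⟨0, by omega⟩
  ext x
  constructor
  · rintro ⟨σ, hσ, hx⟩
    obtain ⟨F, hF, rfl⟩ := (mem_moduliFan hn o).1 hσ
    -- contracting the edges of length zero
    obtain ⟨F', hF', c, hc, rfl⟩ := exists_support hx
    obtain ⟨T, β, hT⟩ := (hF.subset hF').exists_represents hn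
    have : Nonempty T.Vert := ⟨T.root o⟩
    let C : TropicalCurve n :=
      { T with
        length := fun e => c (Function.invFunOn (clusterEdge o F' β) F' e)
        length_pos := fun e he => hc _ (Function.invFunOn_mem (hT.exists_clusterEdge he)) }
    refine ⟨Quotient.mk _ C, ?_⟩
    change qMap n (T.distVec C.length) = _
    rw [hT.qMap_distVec hn]
    exact Finset.sum_congr rfl fun I hI => by
      change c (Function.invFunOn (clusterEdge o F' β) F' _) • _ = _
      rw [hT.clusterEdge_injOn.leftInvOn_invFunOn hI]
  · rintro ⟨C, rfl⟩
    induction C using Quotient.inductionOn with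
    | _ C =>
      exact ⟨C.cell, ⟨C.toMarkedTree, rfl⟩, C.length, fun e he => (C.length_pos e he).le, rfl⟩

/-- The distances determine the splits and the lengths of the bounded edges, and the splits
determine the tree. -/
lemma phiMap_injective (hn : 3 ≤ n) : Function.Injective (phiMap n) := by
  have o : Fin n := ⟨0, by omega⟩
  intro C D hCD
  induction C using Quotient.inductionOn with
  | _ C =>
  induction D using Quotient.inductionOn with
  | _ D =>
  change qMap n (C.distVec C.length) = qMap n (D.distVec D.length) at hCD
  obtain ⟨F, hF⟩ := C.toMarkedTree.exists_represents o
  obtain ⟨G, hG⟩ := D.toMarkedTree.exists_represents o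
  have : Nonempty C.Vert := ⟨C.root o⟩
  have : Nonempty D.Vert := ⟨D.root o⟩
  rw [hF.qMap_distVec hn, hG.qMap_distVec hn] at hCD
  obtain ⟨rfl, hlen⟩ := hF.hierarchy.eq_of_sum_eq hG.hierarchy
    (fun I hI => C.length_pos _ (hF.clusterEdge_mem hI))
    (fun I hI => D.length_pos _ (hG.clusterEdge_mem hI)) hCD
  obtain ⟨f, hf, hroot⟩ := hF.exists_iso hG
  refine Quotient.sound ⟨f, hroot, fun e he => ?_⟩
  obtain ⟨I, hI, rfl⟩ := hF.exists_clusterEdge he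
  rw [hlen I hI]
  congr 1
  have hinv : ∀ A ∈ clusters o F, f (Function.invFun (C.below o) A) =
      Function.invFun (D.below o) A := by
    intro A hA
    apply hG.injective
    rw [hf, hF.apply_invFun hA, hG.apply_invFun hA]
  simp only [clusterEdge, Sym2.map_mk]
  rw [hinv _ (Finset.mem_insert_of_mem hI), hinv _ (hF.hierarchy.parent_spec_of_mem hI).1]

/-! ### Rays, markings and weights -/

lemma hierarchyCone_singleton (I : Finset (Fin n)) : hierarchyCone {I} = ray (splitVec I) := by
  ext x
  constructor
  · rintro ⟨c, hc, rfl⟩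
    exact ⟨c I, hc I (by simp), by simp⟩
  · rintro ⟨c, hc, rfl⟩
    exact ⟨fun _ => c, fun _ _ => hc, by simp⟩

lemma isHierarchy_singleton {I : Finset (Fin n)} (ho : o ∉ I) (h1 : 1 < I.card)
    (h2 : I.card + 1 < n) : IsHierarchy o {I} := by
  constructor <;> simp [ho, h1, h2]

lemma exists_splitVec_eq_splitVector (o : Fin n) (I : SplitIndex n) :
    ∃ J, IsHierarchy o {J} ∧ splitVec J = splitVector I := by
  rw [splitVector_eq]
  obtain ⟨I, h1, h2⟩ := I
  by_cases ho : o ∈ I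
  · refine ⟨Iᶜ, isHierarchy_singleton (by simpa using ho) ?_ ?_, splitVec_compl I⟩ <;>
    rw [Finset.card_compl, Fintype.card_fin] <;> omega
  · exact ⟨I, isHierarchy_singleton ho h1 h2, rfl⟩

lemma splitVector_eq_of_ray_eq (hn : 3 ≤ n) {I J : SplitIndex n}
    (h : ray (splitVector I) = ray (splitVector J)) : splitVector I = splitVector J := by
  have o : Fin n := ⟨0, by omega⟩
  obtain ⟨I', hI', hI⟩ := exists_splitVec_eq_splitVector o I
  obtain ⟨J', hJ', hJ⟩ := exists_splitVec_eq_splitVector o J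
  rw [← hI, ← hJ, ← hierarchyCone_singleton, ← hierarchyCone_singleton] at h
  rw [← hI, ← hJ, Finset.singleton_injective (hI'.cone_inj hJ' h)]

lemma conesOfDim_one_moduliFan (hn : 3 ≤ n) :
    conesOfDim (moduliFan n) 1 = Set.range (fun I : SplitIndex n => ray (splitVector I)) := by
  have o : Fin n := ⟨0, by omega⟩
  ext σ
  constructor
  · rintro ⟨hσ, hd⟩
    obtain ⟨F, hF, rfl⟩ := (mem_moduliFan hn o).1 hσ
    rw [hF.coneDim_eq] at hd
    obtain ⟨I, rfl⟩ := Finset.card_eq_one.1 hd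
    have hI := Finset.mem_singleton_self I
    refine ⟨⟨I, hF.one_lt_card I hI, hF.card_lt I hI⟩, ?_⟩
    rw [hierarchyCone_singleton]
    exact congrArg ray (splitVector_eq _)
  · rintro ⟨I, rfl⟩
    obtain ⟨J, hJ, he⟩ := exists_splitVec_eq_splitVector o I
    change ray (splitVector I) ∈ _
    rw [← he, ← hierarchyCone_singleton]
    exact ⟨(mem_moduliFan hn o).2 ⟨_, hJ, rfl⟩, by rw [hJ.coneDim_eq, Finset.card_singleton]⟩

open Classical in
/-- The marking of the ray `ℝ_{≥ 0} v_I` by `v_I`. -/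
noncomputable def rayMark (n : ℕ) (ρ : Set (Q n)) : Q n :=
  if h : ∃ I : SplitIndex n, ray (splitVector I) = ρ then splitVector h.choose else 0

lemma rayMark_ray (hn : 3 ≤ n) (I : SplitIndex n) :
    rayMark n (ray (splitVector I)) = splitVector I := by
  have h : ∃ J : SplitIndex n, ray (splitVector J) = ray (splitVector I) := ⟨I, rfl⟩
  rw [rayMark, dif_pos h]
  exact splitVector_eq_of_ray_eq hn h.choose_spec

lemma IsHierarchy.rayMark_eq (h : IsHierarchy o F) (hn : 3 ≤ n) {I : Finset (Fin n)}
    (hI : I ∈ F) : rayMark n (hierarchyCone {I}) = splitVec I := by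
  have := rayMark_ray hn ⟨I, h.one_lt_card I hI, h.card_lt I hI⟩
  rwa [splitVector_eq, ← hierarchyCone_singleton] at this

lemma isMarkedFan_moduliFan (hn : 3 ≤ n) :
    IsMarkedFan (splitLattice n) (moduliFan n) (n - 3) (rayMark n) := by
  have o : Fin n := ⟨0, by omega⟩
  refine ⟨isFan_moduliFan hn, hasPureDim_moduliFan hn, fun σ hσ => ?_, fun σ hσ => ?_,
    fun σ hσ => ?_, fun σ hσ => ?_⟩
  · obtain ⟨F, hF, rfl⟩ := (mem_moduliFan hn o).1 hσ
    obtain ⟨f, hf⟩ := hF.exists_isUnimodular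
    exact hf.isSimplicialCone
  all_goals
    have hσ' := hσ
    rw [conesOfDim_one_moduliFan hn] at hσ'
    obtain ⟨I, rfl⟩ := hσ'
    simp only [rayMark_ray hn]
  · exact ⟨1, zero_le_one, (one_smul _ _).symm⟩
  · intro h0
    have hr : ray (splitVector I) = {0} := by
      rw [h0]
      ext x
      constructor
      · rintro ⟨c, -, rfl⟩; simp
      · rintro rfl; exact ⟨0, le_rfl, by simp⟩
    have hd : coneDim (ray (splitVector I)) = 1 := hσ.2
    rw [hr, coneDim, Submodule.span_zero_singleton, finrank_bot] at hd
    omega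
  · exact Submodule.subset_span ⟨I, rfl⟩

/-- The marking vectors of the edges of a cone generate its whole lattice, because the cone is
unimodular. -/
lemma IsHierarchy.markedLattice_eq (h : IsHierarchy o F) (hn : 3 ≤ n) :
    markedLattice (splitLattice n) (moduliFan n) (rayMark n) (hierarchyCone F) =
      coneLattice (splitLattice n) (hierarchyCone F) := by
  obtain ⟨f, hf⟩ := h.exists_isUnimodular
  rw [hf.coneLattice_eq, markedLattice]
  congr 1
  ext x
  constructor
  · rintro ⟨ρ, ⟨-, hd⟩, hface, rfl⟩
    obtain ⟨F', hF', rfl⟩ := (h.isFace_iff hn).1 hface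
    rw [(h.subset hF').coneDim_eq] at hd
    obtain ⟨I, rfl⟩ := Finset.card_eq_one.1 hd
    have hI : I ∈ F := hF' (Finset.mem_singleton_self I)
    exact ⟨I, hI, (h.rayMark_eq hn hI).symm⟩
  · rintro ⟨I, hI, rfl⟩
    have hs : {I} ⊆ F := Finset.singleton_subset_iff.2 hI
    have hI' := h.subset hs
    refine ⟨hierarchyCone {I}, ⟨(mem_moduliFan hn o).2 ⟨_, hI', rfl⟩, ?_⟩,
      (h.isFace_iff hn).2 ⟨_, hs, rfl⟩, (h.rayMark_eq hn hI).symm⟩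
    rw [hI'.coneDim_eq, Finset.card_singleton]

lemma IsHierarchy.markedWeight_eq_one (h : IsHierarchy o F) (hn : 3 ≤ n) :
    markedWeight (splitLattice n) (moduliFan n) (rayMark n) (hierarchyCone F) = 1 := by
  rw [markedWeight, h.markedLattice_eq hn, Submodule.submoduleOf_self]
  exact Nat.card_unique

/-! ### The balancing condition -/

open Classical in
/-- The vector `v_I` for the cone of `insert I F`, where `F` is a hierarchy that does not
contain `I`. -/
noncomputable def addedVec (o : Fin n) (F : Finset (Finset (Fin n))) (σ : Set (Q n)) : Q n :=
  if h : ∃ I, (I ∉ F ∧ IsHierarchy o (insert I F)) ∧ σ = hierarchyCone (insert I F) then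
    splitVec h.choose else 0

lemma insert_cone_injOn (o : Fin n) (F : Finset (Finset (Fin n))) :
    Set.InjOn (fun I => hierarchyCone (insert I F)) {I | I ∉ F ∧ IsHierarchy o (insert I F)} := by
  rintro I ⟨hI, hIF⟩ J ⟨hJ, hJF⟩ he
  have h1 : I ∈ insert J F := hIF.cone_inj hJF he ▸ Finset.mem_insert_self I F
  exact (Finset.mem_insert.1 h1).resolve_right hI

lemma addedVec_eq {I : Finset (Fin n)} (hI : I ∉ F ∧ IsHierarchy o (insert I F)) :
    addedVec o F (hierarchyCone (insert I F)) = splitVec I := by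
  have h : ∃ J, (J ∉ F ∧ IsHierarchy o (insert J F)) ∧
    hierarchyCone (insert I F) = hierarchyCone (insert J F) := ⟨I, hI, rfl⟩
  rw [addedVec, dif_pos h]
  exact congrArg splitVec (insert_cone_injOn o F hI h.choose_spec.1 h.choose_spec.2).symm

/-- The facets around a cone of codimension one are obtained by adding one split. -/
lemma IsHierarchy.facets_eq (h : IsHierarchy o F) (hn : 3 ≤ n) (hF : F.card + 4 = n) :
    {σ | σ ∈ conesOfDim (moduliFan n) (n - 3) ∧ IsFace (splitLattice n) (hierarchyCone F) σ} =
      (fun I => hierarchyCone (insert I F)) '' {I | I ∉ F ∧ IsHierarchy o (insert I F)} := by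
  ext σ
  constructor
  · rintro ⟨⟨hσ, hd⟩, hface⟩
    obtain ⟨G, hG, rfl⟩ := (mem_moduliFan hn o).1 hσ
    have hFG := (hG.isFace_cone_iff hn h).1 hface
    rw [hG.coneDim_eq] at hd
    obtain ⟨I, hI, rfl⟩ := (Finset.covBy_iff_exists_insert (s := F) (t := G)).1
      (Finset.covBy_iff_card_sdiff_eq_one.2 ⟨hFG, by rw [Finset.card_sdiff_of_subset hFG]; omega⟩)
    exact ⟨I, ⟨hI, hG⟩, rfl⟩
  · rintro ⟨I, ⟨hI, hIF⟩, rfl⟩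
    refine ⟨⟨(mem_moduliFan hn o).2 ⟨_, hIF, rfl⟩, ?_⟩,
      (hIF.isFace_cone_iff hn h).2 (Finset.subset_insert I F)⟩
    rw [hIF.coneDim_eq, Finset.card_insert_of_notMem hI]
    omega

lemma IsHierarchy.branch_splitVec_mem (hn : 3 ≤ n) {B : Finset (Fin n)}
    (hB : B ∈ branches o F) : splitVec B ∈ Submodule.span ℝ (hierarchyCone F) := by
  rcases mem_branches.1 hB with hB | ⟨i, -, rfl⟩
  · exact Submodule.subset_span (mem_finCone hB)
  · rw [splitVec_eq_zero_of_card_le_one hn (by simp)]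
    exact Submodule.zero_mem _

lemma IsHierarchy.cluster_splitVec_mem (hn : 3 ≤ n) {A : Finset (Fin n)}
    (hA : A ∈ clusters o F) : splitVec A ∈ Submodule.span ℝ (hierarchyCone F) := by
  rcases mem_clusters.1 hA with rfl | hA
  · rw [splitVec_compl_singleton hn]
    exact Submodule.zero_mem _
  · exact Submodule.subset_span (mem_finCone hA)

/-- The sum of the three normal vectors at a cone of codimension one. -/
lemma IsHierarchy.sum_normal_mem (h : IsHierarchy o F) (hn : 3 ≤ n) (hF : F.card + 4 = n) :
    (∑ᶠ I ∈ {I | I ∉ F ∧ IsHierarchy o (insert I F)}, splitVec I) ∈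
      Submodule.span ℝ (hierarchyCone F) := by
  obtain ⟨A, hA, B₁, B₂, B₃, ⟨hB₁, hB₂, hB₃⟩, ⟨h12, h13, h23⟩, rfl, hI⟩ :=
    h.exists_resolutions hn hF
  have hset : {I | I ∉ F ∧ IsHierarchy o (insert I F)} =
      (({B₁ ∪ B₂, B₁ ∪ B₃, B₂ ∪ B₃} : Finset (Finset (Fin n))) : Set (Finset (Fin n))) :=
    Set.ext hI
  have key : ∀ {X Y Z : Finset (Fin n)}, Disjoint X Y → Disjoint Y Z → Y.Nonempty →
      X ∪ Y ≠ X ∪ Z := by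
    intro X Y Z hXY hYZ ⟨y, hy⟩ he
    rcases Finset.mem_union.1 (he ▸ Finset.mem_union_right X hy) with hy' | hy'
    · exact Finset.disjoint_left.1 hXY hy' hy
    · exact Finset.disjoint_left.1 hYZ hy hy'
  have n1 := h.branch_nonempty hB₁
  have n2 := h.branch_nonempty hB₂
  rw [hset, finsum_mem_coe_finset, Finset.sum_insert, Finset.sum_pair]
  · rw [splitVec_union_add hn (subset_compl_singleton_iff.1 (h.cluster_subset hA)) h12 h13 h23]
    exact Submodule.add_mem _ (cluster_splitVec_mem hn hA)
      (Submodule.add_mem _ (branch_splitVec_mem hn hB₁)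
        (Submodule.add_mem _ (branch_splitVec_mem hn hB₂) (branch_splitVec_mem hn hB₃)))
  · rw [Finset.union_comm B₁, Finset.union_comm B₂]
    exact key h13.symm h12 n1
  · simp only [Finset.mem_insert, Finset.mem_singleton, not_or]
    refine ⟨key h12 h23 n2, ?_⟩
    rw [Finset.union_comm B₁]
    exact key h12.symm h13 n1

lemma isTropicalFan_moduliFan (hn : 3 ≤ n) :
    IsTropicalFan (splitLattice n) (moduliFan n) (n - 3)
      (markedWeight (splitLattice n) (moduliFan n) (rayMark n)) := by
  have o : Fin n := ⟨0, by omega⟩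
  refine ⟨⟨isFan_moduliFan hn, hasPureDim_moduliFan hn, fun σ hσ => ?_⟩, fun τ hτ hd => ?_⟩
  · obtain ⟨F, hF, rfl⟩ := (mem_moduliFan hn o).1 hσ.1
    rw [hF.markedWeight_eq_one hn]
    exact one_pos
  · obtain ⟨F, hF, rfl⟩ := (mem_moduliFan hn o).1 hτ
    rw [hF.coneDim_eq] at hd
    have hFn : F.card + 4 = n := by omega
    have hfacets := hF.facets_eq hn hFn
    refine ⟨addedVec o F, fun σ hσ hface => ?_, ?_⟩
    · have hσ' : σ ∈ {σ | σ ∈ conesOfDim (moduliFan n) (n - 3) ∧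
          IsFace (splitLattice n) (hierarchyCone F) σ} := ⟨hσ, hface⟩
      rw [hfacets] at hσ'
      obtain ⟨I, hI, rfl⟩ := hσ'
      obtain ⟨f, hf⟩ := hI.2.exists_isUnimodular
      simp only [addedVec_eq hI]
      exact hf.isNormalVector hI.1
    · rw [hfacets, finsum_mem_image (insert_cone_injOn o F)]
      rw [finsum_mem_congr rfl (g := splitVec)]
      · exact hF.sum_normal_mem hn hFn
      · intro I hI
        simp only [hI.2.markedWeight_eq_one hn, addedVec_eq hI, Nat.cast_one, one_smul]

end ModuliFan

theorem theorem3p7 (n : ℕ) (hn : 3 ≤ n) :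
    IsLatticeIn (splitLattice n) ∧
    Function.Injective (phiMap n) ∧
    ⋃₀ moduliFan n = Set.range (phiMap n) ∧
    (∀ T : MarkedTree n, coneDim T.cell = T.graph.edgeSet.ncard) ∧
    conesOfDim (moduliFan n) 1 = Set.range (fun I : SplitIndex n => ray (splitVector I)) ∧
    ∃ mark : Set (Q n) → Q n,
      (∀ I : SplitIndex n, mark (ray (splitVector I)) = splitVector I) ∧
      IsMarkedFan (splitLattice n) (moduliFan n) (n - 3) mark ∧
      IsTropicalFan (splitLattice n) (moduliFan n) (n - 3)
        (markedWeight (splitLattice n) (moduliFan n) mark) := by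
  refine ⟨isLatticeIn_splitLattice hn, phiMap_injective hn, sUnion_moduliFan hn, fun T => ?_,
    conesOfDim_one_moduliFan hn, rayMark n, rayMark_ray hn, isMarkedFan_moduliFan hn,
    isTropicalFan_moduliFan hn⟩
  obtain ⟨F, hF⟩ := T.exists_represents ⟨0, by omega⟩
  have : Nonempty T.Vert := ⟨T.root ⟨0, by omega⟩⟩
  rw [hF.cell_eq hn, hF.hierarchy.coneDim_eq, hF.ncard_edgeSet]
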